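/- **Setting.** A stationary episodic MDP $\mathcal M$ with finite state set $\mathcal S$, action set $\mathcal A$ and horizon $H\ge 1$ consists of an initial law $p_0$ on $\mathcal S$, transition laws $p(\cdot\mid x,a)$, and laws of random rewards $R(x,a)\in[0,1]$ with means $r(x,a)$. A policy is $\pi=(\pi_h)_{h=1}^H$ with $\pi_h:\mathcal S\to\mathcal A$. Its value is $V_h^\pi(x)=\mathbb E^\pi\big[\sum_{h'=h}^H r(x_{h'},a_{h'})\mid x_h=x\big]$ (with $V^\pi_{H+1}=0$), and $V_0^\pi=\sum_x p_0(x)V_1^\pi(x)$. Put $V_0^\star=\max_\pi V_0^\pi$, $V^\star_h(x)=\max_\pi V^\pi_h(x)$, $Q^\star_h(x,a)=r(x,a)+\sum_{x'}p(x'\mid x,a)V^\star_{h+1}(x')$ and $\mathtt{gap}_h(x,a)=V_h^\star(x)-Q_h^\star(x,a)\ge 0$. In episode $k$ a (possibly randomized) algorithm picks a policy $\pi_k$ as a function of its past record, and observes the states, actions and rewards of a roll out of $\pi_k$ in $\mathcal M$. Put $\mathrm{Regret}_K=\sum_{k=1}^K(V_0^\star-V_0^{\pi_k})$ and $T=KH$.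 The algorithm may depend on the number $K$ of episodes. For $\alpha\in\mathbb R$ it is *$\alpha$-uniformly good* if for every MDP $\mathcal M$ (with the given state set, action set and horizon) there is $C_{\mathcal M}>0$ with $\mathbb E^{\mathcal M}[\mathrm{Regret}_K]\le C_{\mathcal M}K^\alpha$ for all $K\ge1$. **Proposition (regret lower bound).** There is a universal constant $c>0$ such that the following holds. Let $S\ge2$, $A\ge2$, $H\ge1$, and let $\Delta_{x,a}\in[0,H/8)$ for $x\in[S]$, $a\in[A]$ be such that for every $x\in[S]$ there is an $a\in[A]$ with $\Delta_{x,a}=0$. Then there is an MDP $\mathcal M$ with states $[S+2]$, actions $[A]$ and horizon $H$ such that $$\mathtt{gap}_1(x,a)=\Delta_{x,a}\quad\text{for all }x\in[S],\ a\in[A],$$ $$\mathtt{gap}_h(x,a)\ge \tfrac12\quad\text{for all }h\in[H],\ x\in\{S+1,S+2\},\ a\in[A]\setminus\{1\},$$ and, for every $\alpha\in\mathbb R$, every $\alpha$-uniformly good algorithm satisfies $$\liminf_{K\to\infty}\frac{\mathbb E^{\mathcal M}[\mathrm{Regret}_K]}{\log T}\ \ge\ c\,(1-\alpha)\sum_{x\in[S],\,a\in[A]:\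 \mathtt{gap}_1(x,a)>0}\frac{H^2}{\mathtt{gap}_1(x,a)} .$$ -/

import Mathlib

open MeasureTheory ProbabilityTheory Filter

noncomputable section

namespace EpisodicRL

/-- A stationary episodic MDP with `S` states, `A` actions and horizon `H`: initial state law,
transition law, and, for every state-action pair, a law of the random reward, carried by `[0,1]`.
The horizon enters through the length of policies and of episodes. -/
structure MDP (S A H : ℕ) where
  init : PMF (Fin S)
  trans : Fin S → Fin A → PMF (Fin S)
  rewardLaw : Fin S → Fin A → Measure ℝ
  rewardLaw_prob : ∀ x a, IsProbabilityMeasure (rewardLaw x a)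
  rewardLaw_mem : ∀ x a, ∀ᵐ y ∂(rewardLaw x a), y ∈ Set.Icc (0 : ℝ) 1

/-- A (deterministic, stage-dependent) policy for `n` stages. -/
abbrev Policy (S A n : ℕ) := Fin n → Fin S → Fin A

/-- A roll out over `n` stages: the visited state, the action and the observed reward at each. -/
abbrev Rollout (S A n : ℕ) := Fin n → Fin S × Fin A × ℝ

/-- What is recorded of one episode: the policy that was chosen and the observed roll out. -/
abbrev Episode (S A H : ℕ) := Policy S A H × Rollout S A H

namespace MDP

variable {S A H : ℕ}

/-- The mean reward `r(x,a)`. -/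
def meanReward (M : MDP S A H) (x : Fin S) (a : Fin A) : ℝ := ∫ y, y ∂(M.rewardLaw x a)

/-! ### Values. The index `n` counts the stages that remain: since the MDP is stationary, the value
at stage `h` of a policy with horizon `H` is the `n`-stage value with `n = H + 1 - h` of the
policy's part on the stages `h, …, H`. -/

/-- Expected sum of the mean rewards over `n` stages, started at `x`, under the policy `π`. -/
def value (M : MDP S A H) : (n : ℕ) → Policy S A n → Fin S → ℝ
  | 0, _, _ => 0
  | n + 1, π, x => M.meanReward x (π 0 x)
      + ∑ y, (M.trans x (π 0 x) y).toReal * M.value n (Fin.tail π) y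

/-- `V₀^π`: the expected total reward of `π` over an episode, from the initial law. -/
def value₀ (M : MDP S A H) (π : Policy S A H) : ℝ := ∑ x, (M.init x).toReal * M.value H π x

/-- `V₀^⋆`: the largest value of a policy. -/
def optValue₀ (M : MDP S A H) : ℝ := ⨆ π : Policy S A H, M.value₀ π

/-- The optimal value from `x` when `n` stages remain. -/
def optValue (M : MDP S A H) (n : ℕ) (x : Fin S) : ℝ := ⨆ π : Policy S A n, M.value n π x

/-- `V_h^⋆(x)`, for a stage `h` in `1, …, H + 1`. -/
def Vstar (M : MDP S A H) (h : ℕ) (x : Fin S) : ℝ := M.optValue (H + 1 - h) x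

/-- `Q_h^⋆(x,a) = r(x,a) + p(x,a)ᵀ V_{h+1}^⋆`, for a stage `h` in `1, …, H`. -/
def Qstar (M : MDP S A H) (h : ℕ) (x : Fin S) (a : Fin A) : ℝ :=
  M.meanReward x a + ∑ y, (M.trans x a y).toReal * M.Vstar (h + 1) y

/-- `gap_h(x,a) = V_h^⋆(x) - Q_h^⋆(x,a)`, for a stage `h` in `1, …, H`. -/
def gap (M : MDP S A H) (h : ℕ) (x : Fin S) (a : Fin A) : ℝ := M.Vstar h x - M.Qstar h x a

/-! ### The law of a roll out -/

/-- Law of an `n`-stage roll out from `x` under `π`: action `π 0 x`, a reward from its law, and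
independently a next state from its law, from which the remaining stages are played. -/
def rolloutFrom (M : MDP S A H) : (n : ℕ) → Policy S A n → Fin S → Measure (Rollout S A n)
  | 0, _, _ => Measure.dirac (fun i => i.elim0)
  | n + 1, π, x =>
      ((M.rewardLaw x (π 0 x)).prod
        (∑ y, M.trans x (π 0 x) y • M.rolloutFrom n (Fin.tail π) y)).map
        (fun z => (Fin.cons (x, π 0 x, z.1) z.2 : Rollout S A (n + 1)))

/-- Law of the roll out of one episode under `π`. -/
def rolloutLaw (M : MDP S A H) (π : Policy S A H) : Measure (Rollout S A H) :=
  ∑ x, M.init x • M.rolloutFrom H π x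

/-- The roll out laws as a Markov kernel from (the finitely many) policies. -/
def rolloutKernel (M : MDP S A H) : Kernel (Policy S A H) (Rollout S A H) :=
  Kernel.ofFunOfCountable M.rolloutLaw

instance (M : MDP S A H) (x : Fin S) (a : Fin A) : IsProbabilityMeasure (M.rewardLaw x a) :=
  M.rewardLaw_prob x a

lemma isProbabilityMeasure_mix {β : Type*} [MeasurableSpace β] (p : PMF (Fin S))
    (ν : Fin S → Measure β) (hν : ∀ y, IsProbabilityMeasure (ν y)) :
    IsProbabilityMeasure (∑ y, p y • ν y) := by
  constructor
  have h := p.tsum_coe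
  rw [tsum_fintype] at h
  simpa using h

lemma measurable_cons (n : ℕ) (x : Fin S) (a : Fin A) :
    Measurable (fun z : ℝ × Rollout S A n =>
      (Fin.cons (x, a, z.1) z.2 : Rollout S A (n + 1))) := by
  refine measurable_pi_lambda _ fun i => ?_
  refine Fin.cases ?_ (fun j => ?_) i
  · simp only [Fin.cons_zero]; fun_prop
  · simp only [Fin.cons_succ]; fun_prop

instance isProbabilityMeasure_rolloutFrom (M : MDP S A H) (n : ℕ) (π : Policy S A n)
    (x : Fin S) : IsProbabilityMeasure (M.rolloutFrom n π x) := by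
  induction n generalizing x with
  | zero => unfold rolloutFrom; infer_instance
  | succ n ih =>
    unfold rolloutFrom
    have := isProbabilityMeasure_mix (M.trans x (π 0 x))
      (fun y => M.rolloutFrom n (Fin.tail π) y) (fun y => ih _ y)
    exact Measure.isProbabilityMeasure_map (measurable_cons n _ _).aemeasurable

instance (M : MDP S A H) : IsMarkovKernel M.rolloutKernel :=
  ⟨fun _ => isProbabilityMeasure_mix _ _ fun _ => inferInstance⟩

lemma integrable_meanReward (M : MDP S A H) (n : ℕ) (μ : Measure (Rollout S A n))
    [IsFiniteMeasure μ] :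
    Integrable (fun τ : Rollout S A n => ∑ i, M.meanReward (τ i).1 (τ i).2.1) μ := by
  refine integrable_finsetSum _ fun i _ => ?_
  have hm : Measurable (fun z : Fin S × Fin A => M.meanReward z.1 z.2) := measurable_of_finite _
  refine Integrable.of_bound (C := ∑ x, ∑ a, |M.meanReward x a|)
    (Measurable.aestronglyMeasurable ?_) (ae_of_all _ fun τ => ?_)
  · exact hm.comp (by fun_prop : Measurable fun τ : Rollout S A n => ((τ i).1, (τ i).2.1))
  · rw [Real.norm_eq_abs]
    exact (Finset.single_le_sum (f := fun a => |M.meanReward (τ i).1 a|)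
      (fun _ _ => abs_nonneg _) (Finset.mem_univ _)).trans
      (Finset.single_le_sum (f := fun x => ∑ a, |M.meanReward x a|)
      (fun _ _ => Finset.sum_nonneg fun _ _ => abs_nonneg _) (Finset.mem_univ _))

/-- The value is the expected sum of the mean rewards along a roll out. -/
lemma value_eq_integral (M : MDP S A H) (n : ℕ) (π : Policy S A n) (x : Fin S) :
    M.value n π x = ∫ τ, ∑ i, M.meanReward (τ i).1 (τ i).2.1 ∂(M.rolloutFrom n π x) := by
  induction n generalizing x with
  | zero => simp [value]
  | succ n ih =>
    have hmix := isProbabilityMeasure_mix (M.trans x (π 0 x))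
      (fun y => M.rolloutFrom n (Fin.tail π) y) (fun y => inferInstance)
    rw [rolloutFrom, integral_map (measurable_cons n _ _).aemeasurable]
    · simp only [Fin.sum_univ_succ, Fin.cons_zero, Fin.cons_succ]
      have hi := M.integrable_meanReward n
        (∑ y, M.trans x (π 0 x) y • M.rolloutFrom n (Fin.tail π) y)
      rw [integral_add (integrable_const _) (hi.comp_snd _), integral_const,
        integral_fun_snd (fun τ : Rollout S A n => ∑ i, M.meanReward (τ i).1 (τ i).2.1)]
      rw [integral_finsetSum_measure]
      · simp only [integral_smul_measure, ← ih]
        simp [value]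
      · intro y _
        exact (M.integrable_meanReward n _).smul_measure (PMF.apply_ne_top _ _)
    · exact (M.integrable_meanReward (n + 1) (Measure.map _ _)).aestronglyMeasurable

end MDP

/-- An episodic learning algorithm for `S` states, `A` actions and horizon `H`: for each `k`, a
(possibly randomized) measurable choice of the next policy given the record of `k` episodes. -/
structure Algorithm (S A H : ℕ) where
  choose : (k : ℕ) → Kernel (Fin k → Episode S A H) (Policy S A H)
  isMarkov : ∀ k, IsMarkovKernel (choose k)

namespace Algorithm

variable {S A H : ℕ}

instance (alg : Algorithm S A H) (k : ℕ) : IsMarkovKernel (alg.choose k) := alg.isMarkov k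

/-- The law of the first `K` episodes when `alg` plays on `M`: given the past, the policy is drawn
by the algorithm, and then the roll out from its law under that policy. -/
def historyLaw (M : MDP S A H) (alg : Algorithm S A H) :
    (K : ℕ) → Measure (Fin K → Episode S A H)
  | 0 => Measure.dirac (fun i => i.elim0)
  | K + 1 =>
      (historyLaw M alg K ⊗ₘ (alg.choose K ⊗ₖ Kernel.prodMkLeft _ M.rolloutKernel)).map
        (fun z => (Fin.snoc z.1 z.2 : Fin (K + 1) → Episode S A H))

lemma measurable_snoc (K : ℕ) : Measurable (fun z : (Fin K → Episode S A H) × Episode S A H =>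
    (Fin.snoc z.1 z.2 : Fin (K + 1) → Episode S A H)) := by
  refine measurable_pi_lambda _ fun i => ?_
  refine Fin.lastCases ?_ (fun j => ?_) i
  · simp only [Fin.snoc_last]; fun_prop
  · simp only [Fin.snoc_castSucc]; fun_prop

instance (M : MDP S A H) (alg : Algorithm S A H) (K : ℕ) :
    IsProbabilityMeasure (historyLaw M alg K) := by
  induction K with
  | zero => unfold historyLaw; infer_instance
  | succ K ih =>
    unfold historyLaw
    exact Measure.isProbabilityMeasure_map (measurable_snoc K).aemeasurable

/-- `Regret_K`, a function of the record of the `K` episodes. -/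
def regret (M : MDP S A H) {K : ℕ} (ω : Fin K → Episode S A H) : ℝ :=
  ∑ k, (M.optValue₀ - M.value₀ (ω k).1)

/-- The expectation of `Regret_K` when `alg` plays on `M` (the integrand takes finitely many values
and is measurable). -/
def expectedRegret (M : MDP S A H) (alg : Algorithm S A H) (K : ℕ) : ℝ :=
  ∫ ω, regret M ω ∂(historyLaw M alg K)

/-- `α`-uniform goodness. The algorithm may take the number of episodes as a parameter: `alg K` is
what is played when `K` episodes are announced (a constant family is an algorithm that does not
know `K`). -/
def UniformlyGood (alg : ℕ → Algorithm S A H) (α : ℝ) : Prop :=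
  ∀ M : MDP S A H, ∃ C : ℝ, 0 < C ∧
    ∀ K : ℕ, 1 ≤ K → expectedRegret M (alg K) K ≤ C * (K : ℝ) ^ α

end Algorithm

end EpisodicRL

end

noncomputable section

namespace EpisodicRL

open scoped ENNReal

/-! The hard MDP is a collection of `S` bandits with amplified rewards. An episode starts in a
uniform state of `[S]`, and the first action has a parameter `q x a` that governs both an immediate
Bernoulli reward and the choice between an absorbing state worth 1 per stage and one worth 1/2. With
`H = n + 1` the optimal continuation has value `(1 + n / 2) * q + n / 2`, so lowering the parameter
by δ creates a gap `(1 + n / 2) * δ`, of order `H δ`, while one visit reveals information of order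
only δ², that is `gap² / H²`. A suboptimal pair must be chosen about `S * log K * H² / gap²` times,
each choice costing `gap / S` on average, whence `H² / gap`.

The count is forced by a change of measure (`log_sub_le_plays`). Raising the parameter of one
suboptimal pair slightly above the best one makes it optimal. Up to constants that depend on the
MDPs, a uniformly good algorithm chooses this pair at most `K ^ α` times in the original MDP and
fails to choose it at most `K ^ α` times in the altered one. The two laws of the record must then be
far apart, whereas their distance is controlled by the expected number of choices of the pair.

The distance is measured through the integral of `√L`, with `L` the likelihood ratio
(`exp_neg_half_integral_le`): Jensen bounds it below, and AM-GM, split by the fraction of episodes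
that choose the pair, bounds it above. For each observation `-log l` is replaced by `l⁻¹ - 1`, whose
mean is a χ² divergence with a closed form. The probability `1 / S` of visiting the state enters
both the regret and the divergence, and cancels. -/

/-! ### Elementary laws and the construction of the hard MDP. -/

/-- The Bernoulli law with mean `q`, on the real line. -/
def bernoulliLaw (q : ℝ) : Measure ℝ :=
  ENNReal.ofReal q • Measure.dirac 1 + ENNReal.ofReal (1 - q) • Measure.dirac 0

lemma ofReal_add_ofReal_one_sub {q : ℝ} (hq : q ∈ Set.Icc (0 : ℝ) 1) :
    ENNReal.ofReal q + ENNReal.ofReal (1 - q) = 1 := by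
  rw [← ENNReal.ofReal_add hq.1 (by linarith [hq.2])]; simp

lemma isProbabilityMeasure_bernoulliLaw {q : ℝ} (hq : q ∈ Set.Icc (0 : ℝ) 1) :
    IsProbabilityMeasure (bernoulliLaw q) :=
  ⟨by simpa [bernoulliLaw] using ofReal_add_ofReal_one_sub hq⟩

lemma lintegral_bernoulliLaw (q : ℝ) (f : ℝ → ℝ≥0∞) :
    ∫⁻ y, f y ∂(bernoulliLaw q) = ENNReal.ofReal q * f 1 + ENNReal.ofReal (1 - q) * f 0 := by
  simp [bernoulliLaw, lintegral_add_measure, lintegral_smul_measure]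

lemma integral_bernoulliLaw {q : ℝ} (hq : q ∈ Set.Icc (0 : ℝ) 1) (f : ℝ → ℝ) :
    ∫ y, f y ∂(bernoulliLaw q) = q * f 1 + (1 - q) * f 0 := by
  have hi (y : ℝ) : Integrable f (Measure.dirac y) := integrable_dirac (by simp)
  rw [bernoulliLaw, integral_add_measure ((hi 1).smul_measure ENNReal.ofReal_ne_top)
    ((hi 0).smul_measure ENNReal.ofReal_ne_top), integral_smul_measure, integral_smul_measure]
  simp [ENNReal.toReal_ofReal hq.1, ENNReal.toReal_ofReal (sub_nonneg.2 hq.2)]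

variable {S A H n : ℕ}

/-- The law on `S + 2` states that puts mass `q` and `1 - q` on the last two. -/
def twoPoint (S : ℕ) (q : ℝ) (hq : q ∈ Set.Icc (0 : ℝ) 1) : PMF (Fin (S + 2)) :=
  PMF.ofFintype (Fin.addCases (fun _ => 0) ![ENNReal.ofReal q, ENNReal.ofReal (1 - q)])
    (by simpa [Fin.sum_univ_add] using ofReal_add_ofReal_one_sub hq)

@[simp] lemma twoPoint_castAdd (q : ℝ) (hq) (x : Fin S) : twoPoint S q hq (Fin.castAdd 2 x) = 0 := by
  simp [twoPoint]

@[simp] lemma twoPoint_natAdd (q : ℝ) (hq) (j : Fin 2) : twoPoint S q hq (Fin.natAdd S j)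
    = ![ENNReal.ofReal q, ENNReal.ofReal (1 - q)] j := by
  simp [twoPoint]

/-- The uniform law on the first `S` of `S + 2` states. -/
def entryLaw (S : ℕ) (hS : S ≠ 0) : PMF (Fin (S + 2)) :=
  PMF.ofFintype (Fin.addCases (fun _ => (S : ℝ≥0∞)⁻¹) (fun _ => 0))
    (by simp [Fin.sum_univ_add, ENNReal.mul_inv_cancel, hS])

@[simp] lemma entryLaw_castAdd (hS) (x : Fin S) :
    entryLaw S hS (Fin.castAdd 2 x) = (S : ℝ≥0∞)⁻¹ := by
  simp [entryLaw]

@[simp] lemma entryLaw_natAdd (hS) (j : Fin 2) : entryLaw S hS (Fin.natAdd S j) = 0 := by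
  simp [entryLaw]

/-- The best reward in each of the two absorbing states. -/
def topReward : Fin 2 → ℝ := ![1, 1 / 2]

/-- The deterministic rewards in the two absorbing states. -/
def absorbReward (j : Fin 2) (a : Fin A) : ℝ := topReward j - if (a : ℕ) = 0 then 0 else 1 / 2

lemma absorbReward_le (j : Fin 2) (a : Fin A) : absorbReward j a ≤ topReward j := by
  unfold absorbReward; split_ifs <;> norm_num

lemma absorbReward_mem (j : Fin 2) (a : Fin A) : absorbReward j a ∈ Set.Icc (0 : ℝ) 1 := by
  fin_cases j <;> simp only [absorbReward, topReward, Set.mem_Icc] <;> split_ifs <;> norm_num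

/-- Episodes start uniformly in `[S]`. Action `a` in state `x ∈ [S]` has a Bernoulli reward of mean
`q x a` and leads to the better one of two absorbing states with probability `q x a`, otherwise
to the other one. -/
def gateMDP (H : ℕ) (hS : S ≠ 0) (q : Fin S → Fin A → ℝ)
    (hq : ∀ x a, q x a ∈ Set.Icc (0 : ℝ) 1) : MDP (S + 2) A H where
  init := entryLaw S hS
  trans z a := Fin.addCases (motive := fun _ => PMF (Fin (S + 2)))
    (fun x => twoPoint S (q x a) (hq x a)) (fun j => PMF.pure (Fin.natAdd S j)) z
  rewardLaw z a := Fin.addCases (motive := fun _ => Measure ℝ)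
    (fun x => bernoulliLaw (q x a)) (fun j => Measure.dirac (absorbReward j a)) z
  rewardLaw_prob z a := by
    refine Fin.addCases (fun x => ?_) (fun j => ?_) z
    · simpa using isProbabilityMeasure_bernoulliLaw (hq x a)
    · simp only [Fin.addCases_right]; infer_instance
  rewardLaw_mem z a := by
    refine Fin.addCases (fun x => ?_) (fun j => ?_) z
    · simp only [Fin.addCases_left, bernoulliLaw]
      refine ae_add_measure_iff.2 ⟨?_, ?_⟩ <;> refine Measure.ae_smul_measure ?_ _ <;> simp
    · simpa using absorbReward_mem j a

/-! ### Values, gaps and regret in the hard MDP. -/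

section Family

variable (hS : S ≠ 0) (q : Fin S → Fin A → ℝ) (hq : ∀ x a, q x a ∈ Set.Icc (0 : ℝ) 1)

@[simp] lemma gateMDP_init : (gateMDP H hS q hq).init = entryLaw S hS := rfl

@[simp] lemma gateMDP_trans_castAdd (x : Fin S) (a : Fin A) :
    (gateMDP H hS q hq).trans (Fin.castAdd 2 x) a = twoPoint S (q x a) (hq x a) := by
  simp [gateMDP]

@[simp] lemma gateMDP_trans_natAdd (j : Fin 2) (a : Fin A) :
    (gateMDP H hS q hq).trans (Fin.natAdd S j) a = PMF.pure (Fin.natAdd S j) := by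
  simp [gateMDP]

@[simp] lemma gateMDP_rewardLaw_castAdd (x : Fin S) (a : Fin A) :
    (gateMDP H hS q hq).rewardLaw (Fin.castAdd 2 x) a = bernoulliLaw (q x a) := by
  simp [gateMDP]

@[simp] lemma gateMDP_rewardLaw_natAdd (j : Fin 2) (a : Fin A) :
    (gateMDP H hS q hq).rewardLaw (Fin.natAdd S j) a = Measure.dirac (absorbReward j a) := by
  simp [gateMDP]

lemma gateMDP_meanReward_castAdd (x : Fin S) (a : Fin A) :
    (gateMDP H hS q hq).meanReward (Fin.castAdd 2 x) a = q x a := by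
  simp [MDP.meanReward, integral_bernoulliLaw (hq x a)]

lemma gateMDP_meanReward_natAdd (j : Fin 2) (a : Fin A) :
    (gateMDP H hS q hq).meanReward (Fin.natAdd S j) a = absorbReward j a := by
  simp [MDP.meanReward]

lemma sum_pure_mul {β : Type*} [Fintype β] [DecidableEq β] (z : β) (f : β → ℝ) :
    ∑ y, (PMF.pure z y).toReal * f y = f z := by
  simp [PMF.pure_apply, apply_ite ENNReal.toReal]

lemma sum_twoPoint_mul {r : ℝ} (hr : r ∈ Set.Icc (0 : ℝ) 1) (f : Fin (S + 2) → ℝ) :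
    ∑ y, (twoPoint S r hr y).toReal * f y
      = r * f (Fin.natAdd S 0) + (1 - r) * f (Fin.natAdd S 1) := by
  rw [Fin.sum_univ_add]
  simp only [twoPoint_castAdd, twoPoint_natAdd, Fin.sum_univ_two]
  simp [ENNReal.toReal_ofReal hr.1, ENNReal.toReal_ofReal (sub_nonneg.2 hr.2)]

lemma gateMDP_value_natAdd_le (π : Policy (S + 2) A n) (j : Fin 2) :
    (gateMDP H hS q hq).value n π (Fin.natAdd S j) ≤ n * topReward j := by
  induction n with
  | zero => simp [MDP.value]
  | succ n ih =>
    rw [MDP.value, gateMDP_meanReward_natAdd, gateMDP_trans_natAdd, sum_pure_mul]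
    push_cast
    linarith [ih (Fin.tail π), absorbReward_le j (π 0 (Fin.natAdd S j))]

lemma gateMDP_value_natAdd (π : Policy (S + 2) A n) (j : Fin 2)
    (hπ : ∀ i, ((π i (Fin.natAdd S j) : Fin A) : ℕ) = 0) :
    (gateMDP H hS q hq).value n π (Fin.natAdd S j) = n * topReward j := by
  induction n with
  | zero => simp [MDP.value]
  | succ n ih =>
    rw [MDP.value, gateMDP_meanReward_natAdd, gateMDP_trans_natAdd, sum_pure_mul,
      ih (Fin.tail π) fun i => hπ i.succ, absorbReward, if_pos (hπ 0)]
    push_cast; ring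

/-- A parameter `r` earns `r` at once; the `n` stages after absorption pay at most `n` with
probability `r` and `n / 2` otherwise. The slope `1 + n / 2` in `r` is the amplification by the
horizon. -/
lemma gateMDP_value_castAdd_le (π : Policy (S + 2) A (n + 1)) (x : Fin S) :
    (gateMDP H hS q hq).value (n + 1) π (Fin.castAdd 2 x)
      ≤ (1 + n / 2) * q x (π 0 (Fin.castAdd 2 x)) + n / 2 := by
  rw [MDP.value, gateMDP_meanReward_castAdd, gateMDP_trans_castAdd, sum_twoPoint_mul]
  set r := q x (π 0 (Fin.castAdd 2 x)) with hr
  have h0 := gateMDP_value_natAdd_le (H := H) hS q hq (Fin.tail π) 0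
  have h1 := gateMDP_value_natAdd_le (H := H) hS q hq (Fin.tail π) 1
  have hm := hq x (π 0 (Fin.castAdd 2 x))
  have h0 := mul_le_mul_of_nonneg_left h0 hm.1
  have h1 := mul_le_mul_of_nonneg_left h1 (sub_nonneg.2 hm.2)
  simp only [topReward, Matrix.cons_val_zero, Matrix.cons_val_one, ← hr] at h0 h1
  linarith

lemma gateMDP_value_castAdd (π : Policy (S + 2) A (n + 1)) (x : Fin S)
    (hπ : ∀ i j, ((π i (Fin.natAdd S j) : Fin A) : ℕ) = 0) :
    (gateMDP H hS q hq).value (n + 1) π (Fin.castAdd 2 x)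
      = (1 + n / 2) * q x (π 0 (Fin.castAdd 2 x)) + n / 2 := by
  have h (j : Fin 2) := gateMDP_value_natAdd (H := H) hS q hq (Fin.tail π) j fun i => hπ i.succ j
  rw [MDP.value, gateMDP_meanReward_castAdd, gateMDP_trans_castAdd, sum_twoPoint_mul, h, h]
  simp only [topReward, Matrix.cons_val_zero, Matrix.cons_val_one]
  ring

/-- The stationary policy that plays `b` on the first `S` states and `0` on the last two. -/
def gatePolicy (hA : 0 < A) (n : ℕ) (b : Fin S → Fin A) : Policy (S + 2) A n :=
  fun _ z => Fin.addCases (motive := fun _ => Fin A) b (fun _ => ⟨0, hA⟩) z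

lemma gateMDP_value₀_le (π : Policy (S + 2) A (n + 1)) :
    (gateMDP (n + 1) hS q hq).value₀ π
      ≤ (S : ℝ)⁻¹ * ∑ x, ((1 + n / 2) * q x (π 0 (Fin.castAdd 2 x)) + n / 2) := by
  rw [MDP.value₀, Fin.sum_univ_add, Finset.mul_sum]
  simp only [gateMDP_init, entryLaw_castAdd, entryLaw_natAdd, ENNReal.toReal_inv,
    ENNReal.toReal_natCast, ENNReal.toReal_zero, zero_mul, Finset.sum_const_zero, add_zero]
  gcongr
  exact gateMDP_value_castAdd_le hS q hq π _

lemma le_gateMDP_optValue₀ (hA : 0 < A) (b : Fin S → Fin A) :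
    (S : ℝ)⁻¹ * ∑ x, ((1 + n / 2) * q x (b x) + n / 2)
      ≤ (gateMDP (n + 1) hS q hq).optValue₀ := by
  refine le_of_eq_of_le ?_ (le_ciSup (Set.finite_range _).bddAbove (gatePolicy hA (n + 1) b))
  rw [MDP.value₀, Fin.sum_univ_add, Finset.mul_sum]
  simp only [gateMDP_init, entryLaw_castAdd, entryLaw_natAdd, ENNReal.toReal_inv,
    ENNReal.toReal_natCast, ENNReal.toReal_zero, zero_mul, Finset.sum_const_zero, add_zero]
  refine Finset.sum_congr rfl fun x _ => ?_
  rw [gateMDP_value_castAdd _ _ _ _ _ fun i j => by simp [gatePolicy]]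
  simp [gatePolicy]

lemma gateMDP_optValue_natAdd (hA : 0 < A) (n : ℕ) (j : Fin 2) :
    (gateMDP H hS q hq).optValue n (Fin.natAdd S j) = n * topReward j := by
  have : Nonempty (Policy (S + 2) A n) := ⟨fun _ _ => ⟨0, hA⟩⟩
  refine le_antisymm (ciSup_le fun π => gateMDP_value_natAdd_le hS q hq π j) ?_
  rw [← gateMDP_value_natAdd (H := H) hS q hq (fun _ _ => ⟨0, hA⟩ : Policy (S + 2) A n) j
    fun _ => rfl]
  exact le_ciSup (f := fun π => (gateMDP H hS q hq).value n π (Fin.natAdd S j))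
    (Set.finite_range _).bddAbove _

lemma gateMDP_optValue_castAdd (hA : 0 < A) (x : Fin S) (b : Fin A) (hb : ∀ a, q x a ≤ q x b) :
    (gateMDP H hS q hq).optValue (n + 1) (Fin.castAdd 2 x) = (1 + n / 2) * q x b + n / 2 := by
  have : Nonempty (Policy (S + 2) A (n + 1)) := ⟨fun _ _ => ⟨0, hA⟩⟩
  refine le_antisymm (ciSup_le fun π => (gateMDP_value_castAdd_le hS q hq π x).trans ?_) ?_
  · gcongr
    exact hb _
  · have h := gateMDP_value_castAdd (H := H) hS q hq (gatePolicy hA (n + 1) fun _ => b) x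
      fun i j => by simp [gatePolicy]
    simp only [gatePolicy, Fin.addCases_left] at h
    rw [← h]
    exact le_ciSup (f := fun π => (gateMDP H hS q hq).value (n + 1) π (Fin.castAdd 2 x))
      (Set.finite_range _).bddAbove _

lemma gateMDP_gap_castAdd (hA : 0 < A) (x : Fin S) (a b : Fin A) (hb : ∀ a, q x a ≤ q x b) :
    (gateMDP (n + 1) hS q hq).gap 1 (Fin.castAdd 2 x) a = (1 + n / 2) * (q x b - q x a) := by
  simp only [MDP.gap, MDP.Qstar, MDP.Vstar, gateMDP_meanReward_castAdd, gateMDP_trans_castAdd,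
    sum_twoPoint_mul, Nat.add_sub_cancel]
  rw [gateMDP_optValue_castAdd hS q hq hA x b hb, show n + 1 + 1 - (1 + 1) = n by omega,
    gateMDP_optValue_natAdd _ _ _ hA, gateMDP_optValue_natAdd _ _ _ hA]
  simp only [topReward, Matrix.cons_val_zero, Matrix.cons_val_one]
  ring

lemma gateMDP_gap_natAdd {h : ℕ} (hh : h ≤ H) (j : Fin 2) (a : Fin A) (ha : (a : ℕ) ≠ 0) :
    (gateMDP H hS q hq).gap h (Fin.natAdd S j) a = 1 / 2 := by
  have hA : 0 < A := a.pos
  simp only [MDP.gap, MDP.Qstar, MDP.Vstar, gateMDP_meanReward_natAdd, gateMDP_trans_natAdd,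
    sum_pure_mul, gateMDP_optValue_natAdd _ _ _ hA]
  rw [show H + 1 - h = (H - h) + 1 by omega, show H + 1 - (h + 1) = H - h by omega,
    absorbReward, if_neg ha]
  push_cast; ring

/-- The regret of one episode is at least the mean of the gaps at the first stage. -/
lemma gateMDP_le_regret (hA : 0 < A) (b : Fin S → Fin A) (π : Policy (S + 2) A (n + 1)) :
    (S : ℝ)⁻¹ * ∑ x, (1 + n / 2) * (q x (b x) - q x (π 0 (Fin.castAdd 2 x)))
      ≤ (gateMDP (n + 1) hS q hq).optValue₀ - (gateMDP (n + 1) hS q hq).value₀ π := by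
  refine le_trans (le_of_eq ?_)
    (sub_le_sub (le_gateMDP_optValue₀ hS q hq hA b) (gateMDP_value₀_le hS q hq π))
  rw [← mul_sub, ← Finset.sum_sub_distrib]
  congr 1
  exact Finset.sum_congr rfl fun x _ => by ring

end Family

/-! ### The first state of a roll out under a reweighted start. -/

/-- The value of `g` at the first state of a roll out, and `1` if there is no stage. -/
def firstState (g : Fin S → ℝ) : (n : ℕ) → Rollout S A n → ℝ
  | 0, _ => 1
  | _ + 1, τ => g (τ 0).1

@[fun_prop]
lemma measurable_firstState (g : Fin S → ℝ) (n : ℕ) :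
    Measurable (firstState g n : Rollout S A n → ℝ) := by
  cases n with
  | zero => exact measurable_const
  | succ n => exact (measurable_of_finite g).comp (by fun_prop)

/-- The default 1 is the likelihood ratio of an empty observation, so `F` has to preserve it. -/
lemma firstState_comp (F : ℝ → ℝ) (hF : F 1 = 1) (g : Fin S → ℝ) (n : ℕ) (τ : Rollout S A n) :
    firstState (fun y => F (g y)) n τ = F (firstState g n τ) := by
  cases n with
  | zero => exact hF.symm
  | succ n => rfl

lemma firstState_induction {P : ℝ → Prop} (g : Fin S → ℝ) (h1 : P 1) (hg : ∀ y, P (g y)) (n : ℕ)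
    (τ : Rollout S A n) : P (firstState g n τ) := by
  cases n with
  | zero => exact h1
  | succ n => exact hg _

lemma ae_rolloutFrom_start (M : MDP S A H) (n : ℕ) (π : Policy S A (n + 1))
    (y : Fin S) : ∀ᵐ τ ∂(M.rolloutFrom (n + 1) π y), (τ 0).1 = y ∧ (τ 0).2.1 = π 0 y := by
  rw [MDP.rolloutFrom, ae_map_iff (MDP.measurable_cons n _ _).aemeasurable]
  · simp
  · have h : Measurable fun τ : Rollout S A (n + 1) => ((τ 0).1, (τ 0).2.1) := by fun_prop
    exact h (MeasurableSet.of_discrete (s := {z | z.1 = y ∧ z.2 = π 0 y}))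

lemma lintegral_mix (p : PMF (Fin S)) {β : Type*} [MeasurableSpace β] (ν : Fin S → Measure β)
    (f : β → ℝ≥0∞) : ∫⁻ τ, f τ ∂(∑ y, p y • ν y) = ∑ y, p y * ∫⁻ τ, f τ ∂(ν y) := by
  rw [lintegral_finsetSum_measure]
  simp [lintegral_smul_measure]

lemma integral_mix (p : PMF (Fin S)) {β : Type*} [MeasurableSpace β] (ν : Fin S → Measure β)
    (f : β → ℝ) (hf : ∀ y, Integrable f (ν y)) :
    ∫ τ, f τ ∂(∑ y, p y • ν y) = ∑ y, (p y).toReal * ∫ τ, f τ ∂(ν y) := by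
  rw [integral_finsetSum_measure]
  · simp [integral_smul_measure]
  · exact fun y _ => (hf y).smul_measure (PMF.apply_ne_top _ _)

/-- Reweighting the law of the first state by `g`. -/
lemma lintegral_mix_firstState (M : MDP S A H) (p p' : PMF (Fin S)) (g : Fin S → ℝ)
    (hg : ∀ y, p' y = ENNReal.ofReal (g y) * p y) (n : ℕ) (π : Policy S A n)
    (f : Rollout S A n → ℝ≥0∞) :
    ∫⁻ τ, f τ ∂(∑ y, p' y • M.rolloutFrom n π y)
      = ∫⁻ τ, ENNReal.ofReal (firstState g n τ) * f τ ∂(∑ y, p y • M.rolloutFrom n π y) := by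
  rw [lintegral_mix, lintegral_mix]
  cases n with
  -- With no stage left the start state leaves no trace: both mixtures are the same point mass, and
  -- the ratio is the default 1.
  | zero =>
    have h (r : PMF (Fin S)) : ∑ y, r y = 1 := by
      have := r.tsum_coe
      rwa [tsum_fintype] at this
    simp only [firstState, ENNReal.ofReal_one, one_mul, MDP.rolloutFrom, ← Finset.sum_mul, h]
  | succ n =>
    refine Finset.sum_congr rfl fun y _ => ?_
    rw [hg, mul_comm (ENNReal.ofReal _), mul_assoc,
      ← lintegral_const_mul' _ _ ENNReal.ofReal_ne_top]
    congr 1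
    refine lintegral_congr_ae ?_
    filter_upwards [ae_rolloutFrom_start M n π y] with τ hτ
    simp [firstState, hτ.1]

/-- Equality holds as soon as there is a stage; `hg` serves only the empty roll out, where the left
side is 1. -/
lemma integral_mix_firstState_le (M : MDP S A H) (p : PMF (Fin S)) (g : Fin S → ℝ) (n : ℕ)
    (π : Policy S A n) (hg : 1 ≤ ∑ y, (p y).toReal * g y) :
    ∫ τ, firstState g n τ ∂(∑ y, p y • M.rolloutFrom n π y) ≤ ∑ y, (p y).toReal * g y := by
  cases n with
  | zero =>
    have := MDP.isProbabilityMeasure_mix p (fun y => M.rolloutFrom 0 π y) fun y => inferInstance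
    simpa [firstState] using hg
  | succ n =>
    have hae (y : Fin S) : (fun τ : Rollout S A (n + 1) => firstState g (n + 1) τ)
        =ᵐ[M.rolloutFrom (n + 1) π y] fun _ => g y := by
      filter_upwards [ae_rolloutFrom_start M n π y] with τ hτ
      simp [firstState, hτ.1]
    rw [integral_mix _ _ _ fun y => (integrable_congr (hae y)).2 (integrable_const _)]
    refine le_of_eq (Finset.sum_congr rfl fun y _ => ?_)
    rw [integral_congr_ae (hae y)]
    simp

/-! ### Likelihood ratio and cost of one roll out. -/

/-- The ratio of two Bernoulli laws at an outcome in `{0, 1}`. -/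
def bernoulliRatio (r r' y : ℝ) : ℝ := if y = 1 then r' / r else (1 - r') / (1 - r)

/-- The ratio of two laws `twoPoint` at a state. -/
def twoPointRatio (S : ℕ) (r r' : ℝ) : Fin (S + 2) → ℝ :=
  Fin.addCases (fun _ => 1) ![r' / r, (1 - r') / (1 - r)]

/-- The likelihood ratio of a roll out, when the parameter of the pair `(x₀, a₀)` is changed from
`r` to `r'`. -/
def rolloutRatio (x₀ : Fin S) (a₀ : Fin A) (r r' : ℝ) (τ : Rollout (S + 2) A (n + 1)) : ℝ :=
  if (τ 0).1 = Fin.castAdd 2 x₀ ∧ (τ 0).2.1 = a₀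
  then bernoulliRatio r r' (τ 0).2.2 * firstState (twoPointRatio S r r') n (Fin.tail τ) else 1

/-- A bound on twice the negative logarithm of `rolloutRatio`. -/
def rolloutCost (x₀ : Fin S) (a₀ : Fin A) (r r' : ℝ) (τ : Rollout (S + 2) A (n + 1)) : ℝ :=
  if (τ 0).1 = Fin.castAdd 2 x₀ ∧ (τ 0).2.1 = a₀
  then (bernoulliRatio r r' (τ 0).2.2)⁻¹ - 1
    + ((firstState (twoPointRatio S r r') n (Fin.tail τ))⁻¹ - 1) else 0

lemma bernoulliRatio_pos {r r' : ℝ} (hr : r ∈ Set.Ioo (0 : ℝ) 1) (hr' : r' ∈ Set.Ioo (0 : ℝ) 1)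
    (y : ℝ) : 0 < bernoulliRatio r r' y := by
  unfold bernoulliRatio
  split_ifs
  · exact div_pos hr'.1 hr.1
  · exact div_pos (sub_pos.2 hr'.2) (sub_pos.2 hr.2)

lemma twoPointRatio_pos {r r' : ℝ} (hr : r ∈ Set.Ioo (0 : ℝ) 1) (hr' : r' ∈ Set.Ioo (0 : ℝ) 1)
    (z : Fin (S + 2)) : 0 < twoPointRatio S r r' z := by
  refine Fin.addCases (fun x => ?_) (fun j => ?_) z
  · simp [twoPointRatio]
  · have h0 := div_pos hr'.1 hr.1
    have h1 := div_pos (sub_pos.2 hr'.2) (sub_pos.2 hr.2)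
    fin_cases j <;> simpa [twoPointRatio]

@[fun_prop]
lemma measurable_bernoulliRatio (r r' : ℝ) : Measurable (bernoulliRatio r r') :=
  Measurable.ite (measurableSet_singleton 1) measurable_const measurable_const

lemma measurable_tail (S A n : ℕ) :
    Measurable (Fin.tail : Rollout S A (n + 1) → Rollout S A n) :=
  measurable_pi_lambda _ fun i => by unfold Fin.tail; fun_prop

lemma measurableSet_start (x₀ : Fin S) (a₀ : Fin A) :
    MeasurableSet {τ : Rollout (S + 2) A (n + 1) |
      (τ 0).1 = Fin.castAdd 2 x₀ ∧ (τ 0).2.1 = a₀} := by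
  have h : Measurable fun τ : Rollout (S + 2) A (n + 1) => ((τ 0).1, (τ 0).2.1) := by fun_prop
  exact h (MeasurableSet.of_discrete (s := {z | z.1 = Fin.castAdd 2 x₀ ∧ z.2 = a₀}))

lemma measurable_rolloutRatio (x₀ : Fin S) (a₀ : Fin A) (r r' : ℝ) :
    Measurable (rolloutRatio x₀ a₀ r r' : Rollout (S + 2) A (n + 1) → ℝ) := by
  have := measurable_tail (S + 2) A n
  exact Measurable.ite (measurableSet_start x₀ a₀) (by fun_prop) measurable_const

lemma measurable_rolloutCost (x₀ : Fin S) (a₀ : Fin A) (r r' : ℝ) :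
    Measurable (rolloutCost x₀ a₀ r r' : Rollout (S + 2) A (n + 1) → ℝ) := by
  have := measurable_tail (S + 2) A n
  exact Measurable.ite (measurableSet_start x₀ a₀) (by fun_prop) measurable_const

lemma rolloutRatio_pos {r r' : ℝ} (hr : r ∈ Set.Ioo (0 : ℝ) 1) (hr' : r' ∈ Set.Ioo (0 : ℝ) 1)
    (x₀ : Fin S) (a₀ : Fin A) (τ : Rollout (S + 2) A (n + 1)) : 0 < rolloutRatio x₀ a₀ r r' τ := by
  unfold rolloutRatio
  split_ifs
  · exact mul_pos (bernoulliRatio_pos hr hr' _)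
      (firstState_induction (P := (0 < ·)) _ one_pos (twoPointRatio_pos hr hr') _ _)
  · exact one_pos

/-- This is `-log l ≤ l⁻¹ - 1`, from `1 + t ≤ exp t` at `t = l⁻¹ - 1`. The rational bound avoids
logarithms in all later expectations. -/
lemma exp_neg_inv_sub_one_le {l : ℝ} (hl : 0 < l) : Real.exp (-(l⁻¹ - 1)) ≤ l := by
  rw [Real.exp_neg]
  refine inv_le_of_inv_le₀ hl ?_
  linarith [Real.add_one_le_exp (l⁻¹ - 1)]

lemma exp_neg_rolloutCost_le {r r' : ℝ} (hr : r ∈ Set.Ioo (0 : ℝ) 1)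
    (hr' : r' ∈ Set.Ioo (0 : ℝ) 1) (x₀ : Fin S) (a₀ : Fin A) (τ : Rollout (S + 2) A (n + 1)) :
    Real.exp (-rolloutCost x₀ a₀ r r' τ) ≤ rolloutRatio x₀ a₀ r r' τ := by
  unfold rolloutRatio rolloutCost
  split_ifs
  · rw [neg_add, Real.exp_add]
    have h1 := bernoulliRatio_pos hr hr' (τ 0).2.2
    have h2 : 0 < firstState (twoPointRatio S r r') n (Fin.tail τ) :=
      firstState_induction (P := (0 < ·)) _ one_pos (twoPointRatio_pos hr hr') _ _
    exact mul_le_mul (exp_neg_inv_sub_one_le h1) (exp_neg_inv_sub_one_le h2) (Real.exp_pos _).le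
      h1.le
  · simp

lemma exists_abs_bernoulliRatio_inv_le (r r' : ℝ) :
    ∃ C, 0 ≤ C ∧ ∀ y, |(bernoulliRatio r r' y)⁻¹ - 1| ≤ C := by
  refine ⟨|(r' / r)⁻¹ - 1| + |((1 - r') / (1 - r))⁻¹ - 1|, by positivity, fun y => ?_⟩
  unfold bernoulliRatio
  split_ifs
  · linarith [abs_nonneg (((1 - r') / (1 - r))⁻¹ - 1)]
  · linarith [abs_nonneg ((r' / r)⁻¹ - 1)]

lemma exists_abs_firstState_inv_le (g : Fin S → ℝ) :
    ∃ C, 0 ≤ C ∧ ∀ (n : ℕ) (τ : Rollout S A n), |(firstState g n τ)⁻¹ - 1| ≤ C := by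
  refine ⟨∑ y, |(g y)⁻¹ - 1|, by positivity, fun n τ => ?_⟩
  refine firstState_induction (P := fun v => |v⁻¹ - 1| ≤ ∑ y, |(g y)⁻¹ - 1|) g ?_ (fun y => ?_) n τ
  · simpa using Finset.sum_nonneg fun y _ => abs_nonneg _
  · exact Finset.single_le_sum (f := fun y => |(g y)⁻¹ - 1|) (fun _ _ => abs_nonneg _)
      (Finset.mem_univ _)

lemma exists_abs_rolloutCost_le (x₀ : Fin S) (a₀ : Fin A) (r r' : ℝ) :
    ∃ C, ∀ τ : Rollout (S + 2) A (n + 1), |rolloutCost x₀ a₀ r r' τ| ≤ C := by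
  obtain ⟨C, hC, h⟩ := exists_abs_bernoulliRatio_inv_le r r'
  obtain ⟨D, hD, h'⟩ := exists_abs_firstState_inv_le (A := A) (twoPointRatio S r r')
  refine ⟨C + D, fun τ => ?_⟩
  unfold rolloutCost
  split_ifs
  · exact (abs_add_le _ _).trans (add_le_add (h _) (h' _ _))
  · simpa using add_nonneg hC hD

/-! ### Change of measure and expected cost for one roll out. -/

section Change

variable (hS : S ≠ 0) (q q' : Fin S → Fin A → ℝ) (hq : ∀ x a, q x a ∈ Set.Icc (0 : ℝ) 1)
  (hq' : ∀ x a, q' x a ∈ Set.Icc (0 : ℝ) 1)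

lemma sum_pure_smul {β : Type*} [MeasurableSpace β] (z : Fin S) (ν : Fin S → Measure β) :
    ∑ y, PMF.pure z y • ν y = ν z := by
  simp [PMF.pure_apply, ite_smul]

lemma sum_twoPoint_smul {β : Type*} [MeasurableSpace β] (r : ℝ) (hr)
    (ν : Fin (S + 2) → Measure β) : ∑ y, twoPoint S r hr y • ν y
      = ∑ j, ![ENNReal.ofReal r, ENNReal.ofReal (1 - r)] j • ν (Fin.natAdd S j) := by
  simp [Fin.sum_univ_add]

/-- The absorbing states are never left and do not involve `q`, so the two MDPs can be distinguished
only by the first reward and the first transition. -/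
lemma rolloutFrom_natAdd_eq (n : ℕ) (π : Policy (S + 2) A n) (j : Fin 2) :
    (gateMDP H hS q hq).rolloutFrom n π (Fin.natAdd S j)
      = (gateMDP H hS q' hq').rolloutFrom n π (Fin.natAdd S j) := by
  induction n with
  | zero => rfl
  | succ n ih =>
    simp only [MDP.rolloutFrom, gateMDP_rewardLaw_natAdd, gateMDP_trans_natAdd, sum_pure_smul, ih]

lemma mix_twoPoint_eq (r : ℝ) (hr) (n : ℕ) (π : Policy (S + 2) A n) :
    ∑ y, twoPoint S r hr y • (gateMDP H hS q hq).rolloutFrom n π y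
      = ∑ y, twoPoint S r hr y • (gateMDP H hS q' hq').rolloutFrom n π y := by
  simp only [sum_twoPoint_smul, rolloutFrom_natAdd_eq hS q q' hq hq']

lemma twoPoint_eq_ratio_mul {r r' : ℝ} (hr : r ∈ Set.Ioo (0 : ℝ) 1) (hr' : r' ∈ Set.Ioo (0 : ℝ) 1)
    (h h') (y : Fin (S + 2)) :
    twoPoint S r' h' y = ENNReal.ofReal (twoPointRatio S r r' y) * twoPoint S r h y := by
  have e1 : r' / r * r = r' := div_mul_cancel₀ _ hr.1.ne'
  have e2 : (1 - r') / (1 - r) * (1 - r) = 1 - r' := div_mul_cancel₀ _ (sub_pos.2 hr.2).ne'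
  have p1 : 0 ≤ r' / r := (div_pos hr'.1 hr.1).le
  have p2 : 0 ≤ (1 - r') / (1 - r) := (div_pos (sub_pos.2 hr'.2) (sub_pos.2 hr.2)).le
  refine Fin.addCases (fun x => by simp) (fun j => ?_) y
  fin_cases j
  · simp [twoPointRatio, ← ENNReal.ofReal_mul p1, e1]
  · simp [twoPointRatio, ← ENNReal.ofReal_mul p2, e2]

lemma lintegral_bernoulliRatio {r : ℝ} (hr : r ∈ Set.Ioo (0 : ℝ) 1) (r' : ℝ) (f : ℝ → ℝ≥0∞) :
    ∫⁻ y, f y ∂(bernoulliLaw r')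
      = ∫⁻ y, ENNReal.ofReal (bernoulliRatio r r' y) * f y ∂(bernoulliLaw r) := by
  have e1 : r * (r' / r) = r' := mul_div_cancel₀ _ hr.1.ne'
  have e2 : (1 - r) * ((1 - r') / (1 - r)) = 1 - r' := mul_div_cancel₀ _ (sub_pos.2 hr.2).ne'
  simp only [lintegral_bernoulliLaw, bernoulliRatio, if_true, zero_ne_one, if_false, ← mul_assoc]
  rw [← ENNReal.ofReal_mul hr.1.le, ← ENNReal.ofReal_mul (sub_pos.2 hr.2).le, e1, e2]


lemma lintegral_rolloutFrom_change (x₀ : Fin S) (a₀ : Fin A) (hr : q x₀ a₀ ∈ Set.Ioo (0 : ℝ) 1)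
    (hr' : q' x₀ a₀ ∈ Set.Ioo (0 : ℝ) 1) (hne : ∀ x a, ¬(x = x₀ ∧ a = a₀) → q' x a = q x a)
    (π : Policy (S + 2) A (n + 1)) (x : Fin S)
    {f : Rollout (S + 2) A (n + 1) → ℝ≥0∞} (hf : Measurable f) :
    ∫⁻ τ, f τ ∂((gateMDP H hS q' hq').rolloutFrom (n + 1) π (Fin.castAdd 2 x))
      = ∫⁻ τ, ENNReal.ofReal (rolloutRatio x₀ a₀ (q x₀ a₀) (q' x₀ a₀) τ) * f τ
          ∂((gateMDP H hS q hq).rolloutFrom (n + 1) π (Fin.castAdd 2 x)) := by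
  have hc := MDP.measurable_cons (S := S + 2) n (Fin.castAdd 2 x) (π 0 (Fin.castAdd 2 x))
  have hρ := measurable_rolloutRatio (n := n) x₀ a₀ (q x₀ a₀) (q' x₀ a₀)
  have hmix (M : MDP (S + 2) A H) (p : PMF (Fin (S + 2))) :=
    MDP.isProbabilityMeasure_mix p (fun y => M.rolloutFrom n (Fin.tail π) y) fun y => inferInstance
  simp only [MDP.rolloutFrom, gateMDP_rewardLaw_castAdd, gateMDP_trans_castAdd]
  rw [lintegral_map hf hc, lintegral_map (by fun_prop) hc]
  have := isProbabilityMeasure_bernoulliLaw (hq x (π 0 (Fin.castAdd 2 x)))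
  have := isProbabilityMeasure_bernoulliLaw (hq' x (π 0 (Fin.castAdd 2 x)))
  have hfc := hf.comp hc
  rw [lintegral_prod _ (by fun_prop), lintegral_prod _ (by fun_prop)]
  by_cases hx : x = x₀ ∧ π 0 (Fin.castAdd 2 x) = a₀
  · obtain ⟨rfl, ha⟩ := hx
    simp only [rolloutRatio, Fin.cons_zero, ha, and_self, if_true, Fin.tail_cons]
    rw [lintegral_bernoulliRatio hr]
    refine lintegral_congr fun y => ?_
    -- After absorption the two MDPs agree, so only the weights of the two absorbing states remain
    -- to be changed.
    rw [mix_twoPoint_eq hS q' q hq' hq,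
      lintegral_mix_firstState _ (twoPoint S (q x a₀) (hq x a₀)) _ _
        (twoPoint_eq_ratio_mul hr hr' _ _), ← lintegral_const_mul' _ _ ENNReal.ofReal_ne_top]
    refine lintegral_congr fun τ => ?_
    rw [ENNReal.ofReal_mul (bernoulliRatio_pos hr hr' _).le, mul_assoc]
  · have hq0 := hne _ _ hx
    have hx' : ¬(Fin.castAdd 2 x = Fin.castAdd 2 x₀ ∧ π 0 (Fin.castAdd 2 x) = a₀) := by
      simpa using hx
    simp only [rolloutRatio, Fin.cons_zero, hx', if_false, ENNReal.ofReal_one, one_mul, hq0]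
    simp only [mix_twoPoint_eq hS q' q hq' hq]

/-- Change of measure for one roll out. -/
lemma lintegral_rolloutLaw_change (x₀ : Fin S) (a₀ : Fin A) (hr : q x₀ a₀ ∈ Set.Ioo (0 : ℝ) 1)
    (hr' : q' x₀ a₀ ∈ Set.Ioo (0 : ℝ) 1) (hne : ∀ x a, ¬(x = x₀ ∧ a = a₀) → q' x a = q x a)
    (π : Policy (S + 2) A (n + 1))
    {f : Rollout (S + 2) A (n + 1) → ℝ≥0∞} (hf : Measurable f) :
    ∫⁻ τ, f τ ∂((gateMDP (n + 1) hS q' hq').rolloutLaw π)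
      = ∫⁻ τ, ENNReal.ofReal (rolloutRatio x₀ a₀ (q x₀ a₀) (q' x₀ a₀) τ) * f τ
          ∂((gateMDP (n + 1) hS q hq).rolloutLaw π) := by
  rw [MDP.rolloutLaw, MDP.rolloutLaw, lintegral_mix, lintegral_mix, Fin.sum_univ_add,
    Fin.sum_univ_add]
  simp only [gateMDP_init, entryLaw_natAdd, zero_mul, Finset.sum_const_zero, add_zero]
  exact Finset.sum_congr rfl fun x _ => by
    rw [lintegral_rolloutFrom_change hS q q' hq hq' x₀ a₀ hr hr' hne π x hf]

lemma integrable_of_abs_le {Ω : Type*} [MeasurableSpace Ω] (μ : Measure Ω) [IsFiniteMeasure μ]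
    {f : Ω → ℝ} (hf : Measurable f) {C : ℝ} (hC : ∀ ω, |f ω| ≤ C) : Integrable f μ :=
  Integrable.of_bound hf.aestronglyMeasurable C (ae_of_all _ hC)

lemma integrable_rolloutCost (x₀ : Fin S) (a₀ : Fin A) (r r' : ℝ)
    (μ : Measure (Rollout (S + 2) A (n + 1))) [IsFiniteMeasure μ] :
    Integrable (rolloutCost x₀ a₀ r r') μ := by
  obtain ⟨C, hC⟩ := exists_abs_rolloutCost_le (n := n) x₀ a₀ r r'
  exact integrable_of_abs_le μ (measurable_rolloutCost x₀ a₀ r r') hC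

/-- The left side is the mean of `l⁻¹ - 1` under parameter `r`, the χ² divergence of the law `r`
from the law `r'`. -/
lemma chiSq_bernoulli {r r' : ℝ} (hr : r ∈ Set.Ioo (0 : ℝ) 1) (hr' : r' ∈ Set.Ioo (0 : ℝ) 1) :
    r * (r' / r)⁻¹ + (1 - r) * ((1 - r') / (1 - r))⁻¹ - 1 = (r - r') ^ 2 / (r' * (1 - r')) := by
  have h1 := hr.1.ne'
  have h2 := (sub_pos.2 hr.2).ne'
  have h3 := hr'.1.ne'
  have h4 := (sub_pos.2 hr'.2).ne'
  field_simp
  ring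

/-- The factor 2 counts the two observations that depend on the parameter, the reward and the next
state. For `n = 0` the second is absent, hence an inequality. -/
lemma integral_rolloutFrom_cost_le (x₀ : Fin S) (a₀ : Fin A) {r r' : ℝ}
    (hr : r ∈ Set.Ioo (0 : ℝ) 1) (hr' : r' ∈ Set.Ioo (0 : ℝ) 1) (h₀ : q x₀ a₀ = r)
    (π : Policy (S + 2) A (n + 1)) (x : Fin S) :
    ∫ τ, rolloutCost x₀ a₀ r r' τ ∂((gateMDP H hS q hq).rolloutFrom (n + 1) π (Fin.castAdd 2 x))
      ≤ if x = x₀ ∧ π 0 (Fin.castAdd 2 x) = a₀ then 2 * ((r - r') ^ 2 / (r' * (1 - r'))) else 0 := by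
  have hc := MDP.measurable_cons (S := S + 2) n (Fin.castAdd 2 x) (π 0 (Fin.castAdd 2 x))
  have hmix (M : MDP (S + 2) A H) (p : PMF (Fin (S + 2))) :=
    MDP.isProbabilityMeasure_mix p (fun y => M.rolloutFrom n (Fin.tail π) y) fun y => inferInstance
  rw [MDP.rolloutFrom, integral_map hc.aemeasurable
    (measurable_rolloutCost _ _ _ _).aestronglyMeasurable]
  split_ifs with hx
  · obtain ⟨rfl, ha⟩ := hx
    simp only [gateMDP_rewardLaw_castAdd, gateMDP_trans_castAdd, rolloutCost, Fin.cons_zero, ha,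
      and_self, if_true, Fin.tail_cons, h₀]
    have hm : r ∈ Set.Icc (0 : ℝ) 1 := ⟨hr.1.le, hr.2.le⟩
    have := isProbabilityMeasure_bernoulliLaw hm
    have hmixp := hmix (gateMDP H hS q hq) (twoPoint S r hm)
    obtain ⟨C, -, hC⟩ := exists_abs_bernoulliRatio_inv_le r r'
    obtain ⟨D, -, hD⟩ := exists_abs_firstState_inv_le (A := A) (twoPointRatio S r r')
    have i1 : Integrable (fun y => (bernoulliRatio r r' y)⁻¹ - 1) (bernoulliLaw r) :=
      integrable_of_abs_le _ (by fun_prop) hC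
    have i2 : Integrable (fun τ => (firstState (twoPointRatio S r r') n τ)⁻¹ - 1)
        (∑ y, twoPoint S r hm y • (gateMDP H hS q hq).rolloutFrom n (Fin.tail π) y) :=
      integrable_of_abs_le _ (by fun_prop) (hD n)
    have i2' : Integrable (fun τ => (firstState (twoPointRatio S r r') n τ)⁻¹)
        (∑ y, twoPoint S r hm y • (gateMDP H hS q hq).rolloutFrom n (Fin.tail π) y) := by
      refine (i2.add (integrable_const (1 : ℝ))).congr (ae_of_all _ fun τ => ?_)
      simp
    rw [integral_add (i1.comp_fst _) (i2.comp_snd _),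
      integral_fun_fst (fun y => (bernoulliRatio r r' y)⁻¹ - 1),
      integral_fun_snd (fun τ => (firstState (twoPointRatio S r r') n τ)⁻¹ - 1)]
    have hχ := chiSq_bernoulli hr hr'
    have hχ0 : 0 ≤ (r - r') ^ 2 / (r' * (1 - r')) :=
      div_nonneg (sq_nonneg _) (mul_pos hr'.1 (sub_pos.2 hr'.2)).le
    have b1 : ∫ y, ((bernoulliRatio r r' y)⁻¹ - 1) ∂(bernoulliLaw r)
        = (r - r') ^ 2 / (r' * (1 - r')) := by
      rw [integral_bernoulliLaw hm, ← hχ]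
      simp only [bernoulliRatio, if_true, zero_ne_one, if_false]
      ring
    have b2 : ∫ τ, ((firstState (twoPointRatio S r r') n τ)⁻¹ - 1)
        ∂(∑ y, twoPoint S r hm y • (gateMDP H hS q hq).rolloutFrom n (Fin.tail π) y)
        ≤ (r - r') ^ 2 / (r' * (1 - r')) := by
      rw [integral_sub i2' (integrable_const _), ← hχ]
      have e : ∑ y, (twoPoint S r hm y).toReal * (twoPointRatio S r r' y)⁻¹
          = r * (r' / r)⁻¹ + (1 - r) * ((1 - r') / (1 - r))⁻¹ := by
        rw [sum_twoPoint_mul]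
        simp [twoPointRatio]
      have := integral_mix_firstState_le (gateMDP H hS q hq) (twoPoint S r hm)
        (fun y => (twoPointRatio S r r' y)⁻¹) n (Fin.tail π) (by rw [e]; linarith)
      simp only [firstState_comp (fun v => v⁻¹) inv_one, e] at this
      simpa using this
    simp only [probReal_univ, one_smul]
    linarith
  · have hx' : ¬(Fin.castAdd 2 x = Fin.castAdd 2 x₀ ∧ π 0 (Fin.castAdd 2 x) = a₀) := by
      simpa using hx
    simp [rolloutCost, hx]

lemma integral_rolloutLaw_cost_le (x₀ : Fin S) (a₀ : Fin A) {r r' : ℝ}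
    (hr : r ∈ Set.Ioo (0 : ℝ) 1) (hr' : r' ∈ Set.Ioo (0 : ℝ) 1) (h₀ : q x₀ a₀ = r)
    (π : Policy (S + 2) A (n + 1)) :
    ∫ τ, rolloutCost x₀ a₀ r r' τ ∂((gateMDP (n + 1) hS q hq).rolloutLaw π)
      ≤ 2 * ((r - r') ^ 2 / (r' * (1 - r'))) / S
        * if π 0 (Fin.castAdd 2 x₀) = a₀ then 1 else 0 := by
  rw [MDP.rolloutLaw, integral_mix _ _ _ fun y => integrable_rolloutCost _ _ _ _ _,
    Fin.sum_univ_add]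
  simp only [gateMDP_init, entryLaw_castAdd, entryLaw_natAdd, ENNReal.toReal_inv,
    ENNReal.toReal_natCast, ENNReal.toReal_zero, zero_mul, Finset.sum_const_zero, add_zero]
  refine (Finset.sum_le_sum fun x _ => mul_le_mul_of_nonneg_left
    (integral_rolloutFrom_cost_le hS q hq x₀ a₀ hr hr' h₀ π x) (by positivity)).trans
    (le_of_eq ?_)
  rw [Finset.sum_eq_single x₀ (fun x _ hx => by simp [hx]) (by simp)]
  split_ifs with h1 h2 h2
  · ring
  · exact absurd h1.2 h2
  · exact absurd ⟨rfl, h2⟩ h1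
  · simp

end Change

/-! ### From one roll out to the record of `K` episodes. -/

section History

variable (M M' : MDP S A H) (alg : Algorithm S A H)

/-- The law of the next episode, given the record of `K` episodes. -/
def episodeKernel (K : ℕ) : Kernel (Fin K → Episode S A H) (Episode S A H) :=
  alg.choose K ⊗ₖ Kernel.prodMkLeft _ M.rolloutKernel

instance (K : ℕ) : IsMarkovKernel (episodeKernel M alg K) := by
  unfold episodeKernel; infer_instance

lemma historyLaw_succ (K : ℕ) : Algorithm.historyLaw M alg (K + 1)
    = (Algorithm.historyLaw M alg K ⊗ₘ episodeKernel M alg K).map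
        (fun z => (Fin.snoc z.1 z.2 : Fin (K + 1) → Episode S A H)) := rfl

lemma lintegral_episodeKernel (K : ℕ) (ω : Fin K → Episode S A H) {f : Episode S A H → ℝ≥0∞}
    (hf : Measurable f) : ∫⁻ e, f e ∂(episodeKernel M alg K ω)
      = ∫⁻ π, ∫⁻ τ, f (π, τ) ∂(M.rolloutLaw π) ∂(alg.choose K ω) :=
  Kernel.lintegral_compProd _ _ _ hf

lemma integral_episodeKernel (K : ℕ) (ω : Fin K → Episode S A H) {f : Episode S A H → ℝ}
    (hf : Integrable f (episodeKernel M alg K ω)) : ∫ e, f e ∂(episodeKernel M alg K ω)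
      = ∫ π, ∫ τ, f (π, τ) ∂(M.rolloutLaw π) ∂(alg.choose K ω) :=
  ProbabilityTheory.integral_compProd hf

lemma lintegral_historyLaw_succ (K : ℕ) {f : (Fin (K + 1) → Episode S A H) → ℝ≥0∞}
    (hf : Measurable f) : ∫⁻ ω, f ω ∂(Algorithm.historyLaw M alg (K + 1))
      = ∫⁻ ω, ∫⁻ e, f (Fin.snoc (α := fun _ => Episode S A H) ω e) ∂(episodeKernel M alg K ω)
          ∂(Algorithm.historyLaw M alg K) := by
  have hs := Algorithm.measurable_snoc (S := S) (A := A) (H := H) K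
  rw [historyLaw_succ, lintegral_map hf hs]
  exact Measure.lintegral_compProd (hf.comp hs)

/-- Change of measure for the record of `K` episodes. -/
lemma lintegral_historyLaw_change {ρ : Rollout S A H → ℝ} (hρ : Measurable ρ) (h0 : ∀ τ, 0 ≤ ρ τ)
    (hM : ∀ (π : Policy S A H) (f : Rollout S A H → ℝ≥0∞), Measurable f →
      ∫⁻ τ, f τ ∂(M'.rolloutLaw π) = ∫⁻ τ, ENNReal.ofReal (ρ τ) * f τ ∂(M.rolloutLaw π))
    (K : ℕ) {f : (Fin K → Episode S A H) → ℝ≥0∞} (hf : Measurable f) :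
    ∫⁻ ω, f ω ∂(Algorithm.historyLaw M' alg K)
      = ∫⁻ ω, ENNReal.ofReal (∏ k, ρ (ω k).2) * f ω ∂(Algorithm.historyLaw M alg K) := by
  induction K with
  | zero => simp [Algorithm.historyLaw]
  | succ K ih =>
    have hfs : Measurable fun z : (Fin K → Episode S A H) × Episode S A H =>
        f (Fin.snoc (α := fun _ => Episode S A H) z.1 z.2) :=
      hf.comp (Algorithm.measurable_snoc K)
    have hfω (ω : Fin K → Episode S A H) : Measurable fun e : Episode S A H =>
        f (Fin.snoc (α := fun _ => Episode S A H) ω e) := hfs.comp measurable_prodMk_left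
    -- The algorithm draws the policy from the same kernel under both MDPs, so the last episode
    -- contributes only the ratio of its roll out.
    rw [lintegral_historyLaw_succ _ _ _ hf, lintegral_historyLaw_succ _ _ _ (by fun_prop),
      ih hfs.lintegral_kernel_prod_right']
    refine lintegral_congr fun ω => ?_
    have e (π : Policy S A H) (τ : Rollout S A H) :
        ENNReal.ofReal (∏ k, ρ (Fin.snoc (α := fun _ => Episode S A H) ω (π, τ) k).2)
          = ENNReal.ofReal (∏ k, ρ (ω k).2) * ENNReal.ofReal (ρ τ) := by
      rw [Fin.prod_univ_castSucc, ENNReal.ofReal_mul (Finset.prod_nonneg fun k _ => h0 _)]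
      simp
    rw [lintegral_episodeKernel _ _ _ _ (hfω ω), lintegral_episodeKernel,
      ← lintegral_const_mul' _ _ ENNReal.ofReal_ne_top]
    · refine lintegral_congr fun π => ?_
      rw [hM _ (fun τ => f (Fin.snoc (α := fun _ => Episode S A H) ω (π, τ)))
        ((hfω ω).comp measurable_prodMk_left), ← lintegral_const_mul' _ _ ENNReal.ofReal_ne_top]
      exact lintegral_congr fun τ => by rw [e, mul_assoc]
    · refine Measurable.mul (Measurable.ennreal_ofReal ?_) (hfω ω)
      have hs : Measurable fun e : Episode S A H => Fin.snoc (α := fun _ => Episode S A H) ω e :=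
        (Algorithm.measurable_snoc K).comp measurable_prodMk_left
      fun_prop

/-- If the conditional mean of `f` given the policy is never positive, then neither is the mean of
the sum of `f` over the episodes. -/
lemma integral_sum_historyLaw_nonpos {f : Episode S A H → ℝ} (hf : Measurable f) {C : ℝ}
    (hC : ∀ e, |f e| ≤ C) (h : ∀ π, ∫ τ, f (π, τ) ∂(M.rolloutLaw π) ≤ 0) (K : ℕ) :
    ∫ ω, ∑ k, f (ω k) ∂(Algorithm.historyLaw M alg K) ≤ 0 := by
  induction K with
  | zero => simp
  | succ K ih =>
    have h1 : Integrable (fun z : (Fin K → Episode S A H) × Episode S A H => ∑ k, f (z.1 k))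
        (Algorithm.historyLaw M alg K ⊗ₘ episodeKernel M alg K) := integrable_finsetSum _ fun k _ =>
      integrable_of_abs_le _ (by fun_prop) fun z => hC (z.1 k)
    have h2 : Integrable (fun z : (Fin K → Episode S A H) × Episode S A H => f z.2)
        (Algorithm.historyLaw M alg K ⊗ₘ episodeKernel M alg K) :=
      integrable_of_abs_le _ (by fun_prop) fun z => hC z.2
    have hm (K : ℕ) : Measurable fun ω : Fin K → Episode S A H => ∑ k, f (ω k) := by fun_prop
    rw [historyLaw_succ, integral_map (Algorithm.measurable_snoc K).aemeasurable
      (hm _).aestronglyMeasurable]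
    simp only [Fin.sum_univ_castSucc, Fin.snoc_castSucc, Fin.snoc_last]
    rw [integral_add h1 h2]
    have e1 : ∫ z, ∑ k, f (z.1 k) ∂(Algorithm.historyLaw M alg K ⊗ₘ episodeKernel M alg K)
        = ∫ ω, ∑ k, f (ω k) ∂(Algorithm.historyLaw M alg K) := by
      conv_rhs => rw [← Measure.fst_compProd (Algorithm.historyLaw M alg K)
        (episodeKernel M alg K), Measure.fst, integral_map measurable_fst.aemeasurable
          (hm _).aestronglyMeasurable]
    rw [e1, Measure.integral_compProd h2]
    refine add_nonpos ih (integral_nonpos fun ω => ?_)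
    simp only [Pi.zero_apply]
    rw [integral_episodeKernel _ _ _ _ (integrable_of_abs_le _ hf hC)]
    exact integral_nonpos h

end History

/-! ### The inequality between two laws and a test variable. -/

lemma sqrt_mul_le {L η : ℝ} (hL : 0 ≤ L) (hη : 0 < η) : √L ≤ (L * η + η⁻¹) / 2 := by
  have h := sq_nonneg (√L * η - 1)
  have e : √L ^ 2 = L := Real.sq_sqrt hL
  have : 2 * √L * η ≤ (L * η + η⁻¹) * η := by
    rw [add_mul, inv_mul_cancel₀ hη.ne']
    have e' : L * η * η = (√L * η) ^ 2 := by rw [mul_pow, e]; ring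
    linarith
  have := le_of_mul_le_mul_right this hη
  linarith

/-- A lower bound on the cost `W` of the change from `P` to the law of density `L`, from a variable
`V` that is small under `P` and close to `1` under the other law. -/
lemma exp_neg_half_integral_le {Ω : Type*} [MeasurableSpace Ω] {P P' : Measure Ω}
    [IsProbabilityMeasure P] [IsProbabilityMeasure P'] {L W V : Ω → ℝ} (hLm : Measurable L)
    (hL0 : ∀ ω, 0 ≤ L ω)
    (hP : ∀ f : Ω → ℝ≥0∞, Measurable f → ∫⁻ ω, f ω ∂P' = ∫⁻ ω, ENNReal.ofReal (L ω) * f ω ∂P)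
    (hW : Integrable W P) (hWL : ∀ ω, Real.exp (-W ω) ≤ L ω) (hVm : Measurable V)
    (hV : ∀ ω, V ω ∈ Set.Icc (0 : ℝ) 1) {η : ℝ} (hη : 0 < η) :
    Real.exp (-(∫ ω, W ω ∂P) / 2)
      ≤ (η + (∫ ω, V ω ∂P) / η + (∫ ω, (1 - V ω) ∂P') / η + η) / 2 := by
  have hd : P' = P.withDensity fun ω => ENNReal.ofReal (L ω) := by
    ext s hs
    rw [withDensity_apply _ hs, ← lintegral_indicator_one hs,
      hP _ (measurable_one.indicator hs), ← lintegral_indicator hs]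
    refine lintegral_congr fun ω => ?_
    by_cases h : ω ∈ s <;> simp [h]
  have hint (f : Ω → ℝ) : ∫ ω, f ω ∂P' = ∫ ω, L ω * f ω ∂P := by
    rw [hd, integral_withDensity_eq_integral_toReal_smul hLm.ennreal_ofReal
      (ae_of_all _ fun _ => ENNReal.ofReal_lt_top)]
    simp [ENNReal.toReal_ofReal (hL0 _)]
  have hLi : Integrable L P := by
    refine ⟨hLm.aestronglyMeasurable, ?_⟩
    rw [hasFiniteIntegral_iff_ofReal (ae_of_all _ hL0)]
    have h := hP (fun _ => 1) measurable_const
    simp only [mul_one, lintegral_const, measure_univ] at h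
    simp [← h]
  have hL1 : ∫ ω, L ω ∂P = 1 := by simpa using (hint fun _ => 1).symm
  have hVi : Integrable V P := integrable_of_abs_le (C := 1) P hVm fun ω => by
    rw [abs_of_nonneg (hV ω).1]; exact (hV ω).2
  have hLVi : Integrable (fun ω => L ω * (1 - V ω)) P := by
    refine hLi.mul_bdd (c := 1) (by fun_prop) (ae_of_all _ fun ω => ?_)
    rw [Real.norm_of_nonneg (sub_nonneg.2 (hV ω).2)]
    linarith [(hV ω).1]
  have hexp (ω : Ω) : Real.exp (-(W ω) / 2) ≤ √(L ω) := by
    refine Real.le_sqrt_of_sq_le ?_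
    rw [← Real.exp_nat_mul]
    convert hWL ω using 2
    push_cast; ring
  set m := ∫ ω, W ω ∂P with hm
  -- Jensen's inequality for `exp`, through the tangent at `-m / 2`: the linear term integrates to
  -- zero.
  have htan (ω : Ω) : Real.exp (-m / 2) * (1 + (m - W ω) / 2) ≤ √(L ω) := by
    refine le_trans ?_ (hexp ω)
    have : Real.exp (-(W ω) / 2) = Real.exp (-m / 2) * Real.exp ((m - W ω) / 2) := by
      rw [← Real.exp_add]; ring_nf
    rw [this]
    gcongr
    linarith [Real.add_one_le_exp ((m - W ω) / 2)]
  -- Split `√L = V √L + (1 - V) √L` and apply AM-GM with weight `η` to the first part and `η⁻¹` to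
  -- the second. The large factor `η⁻¹` then falls on `V` under `P` and on `1 - V` under `P'`, both
  -- of which have small mean.
  have hupper (ω : Ω) : √(L ω) ≤ (L ω * η + V ω / η + L ω * (1 - V ω) / η + η) / 2 := by
    have h1 := mul_le_mul_of_nonneg_left (sqrt_mul_le (hL0 ω) hη) (hV ω).1
    have h2 := mul_le_mul_of_nonneg_left (sqrt_mul_le (hL0 ω) (inv_pos.2 hη))
      (sub_nonneg.2 (hV ω).2)
    rw [inv_inv] at h2
    have h3 : V ω * (L ω * η) ≤ L ω * η := mul_le_of_le_one_left (by have := hL0 ω; positivity)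
      (hV ω).2
    have h4 : (1 - V ω) * η ≤ η := mul_le_of_le_one_left hη.le (by linarith [(hV ω).1])
    simp only [div_eq_mul_inv] at h1 h2 ⊢
    linarith
  have i1 : Integrable (fun ω => (m - W ω) / 2) P := ((integrable_const _).sub hW).div_const _
  have i2 : Integrable (fun ω => L ω * η) P := hLi.mul_const _
  have i3 : Integrable (fun ω => V ω / η) P := hVi.div_const _
  have i4 : Integrable (fun ω => L ω * (1 - V ω) / η) P := hLVi.div_const _
  have i5 : Integrable (fun ω => L ω * η + V ω / η) P := i2.add i3
  have i6 : Integrable (fun ω => L ω * η + V ω / η + L ω * (1 - V ω) / η) P := i5.add i4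
  calc Real.exp (-m / 2) = ∫ ω, Real.exp (-m / 2) * (1 + (m - W ω) / 2) ∂P := by
        rw [integral_const_mul, integral_add (integrable_const _) i1, integral_div,
          integral_sub (integrable_const _) hW, ← hm]
        simp
    _ ≤ ∫ ω, (L ω * η + V ω / η + L ω * (1 - V ω) / η + η) / 2 ∂P :=
        integral_mono (((integrable_const _).add i1).const_mul _)
          ((i6.add (integrable_const _)).div_const _) fun ω => (htan ω).trans (hupper ω)
    _ = _ := by
        rw [integral_div, integral_add i6 (integrable_const _), integral_add i5 i4,
          integral_add i2 i3, integral_mul_const, integral_div, integral_div, hint, hL1]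
        simp

/-! ### Regret in terms of the number of plays. -/

/-- The number of episodes whose policy starts with action `a` in state `x`. -/
def plays (x : Fin S) (a : Fin A) {K : ℕ} (ω : Fin K → Episode (S + 2) A (n + 1)) : ℝ :=
  ∑ k, if (ω k).1 0 (Fin.castAdd 2 x) = a then 1 else 0

lemma plays_nonneg (x : Fin S) (a : Fin A) {K : ℕ} (ω : Fin K → Episode (S + 2) A (n + 1)) :
    0 ≤ plays x a ω := Finset.sum_nonneg fun k _ => by split_ifs <;> norm_num

lemma plays_le (x : Fin S) (a : Fin A) {K : ℕ} (ω : Fin K → Episode (S + 2) A (n + 1)) :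
    plays x a ω ≤ K := by
  refine (Finset.sum_le_sum (g := fun _ => (1 : ℝ)) fun k _ => ?_).trans (by simp)
  split_ifs <;> norm_num

lemma measurable_policy {β : Type*} [MeasurableSpace β] (g : Policy S A H → β) : Measurable g :=
  measurable_of_finite g

lemma measurable_plays (x : Fin S) (a : Fin A) (K : ℕ) :
    Measurable (plays x a : (Fin K → Episode (S + 2) A (n + 1)) → ℝ) :=
  Finset.measurable_fun_sum _ fun k _ => (measurable_policy
    fun π : Policy (S + 2) A (n + 1) => if π 0 (Fin.castAdd 2 x) = a then (1 : ℝ) else 0).comp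
      (by fun_prop)

lemma integrable_plays (x : Fin S) (a : Fin A) (K : ℕ)
    (μ : Measure (Fin K → Episode (S + 2) A (n + 1))) [IsFiniteMeasure μ] :
    Integrable (plays x a) μ :=
  integrable_of_abs_le μ (measurable_plays x a K) fun ω => by
    rw [abs_of_nonneg (plays_nonneg x a ω)]; exact plays_le x a ω

lemma integrable_regret (M : MDP S A H) (K : ℕ) (μ : Measure (Fin K → Episode S A H))
    [IsFiniteMeasure μ] : Integrable (Algorithm.regret M : (Fin K → Episode S A H) → ℝ) μ := by
  refine integrable_finsetSum _ fun k _ => integrable_of_abs_le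
    (C := ∑ π, |M.optValue₀ - M.value₀ π|) μ
    ((measurable_policy fun π => M.optValue₀ - M.value₀ π).comp (by fun_prop)) fun ω => ?_
  exact Finset.single_le_sum (f := fun π => |M.optValue₀ - M.value₀ π|)
    (fun _ _ => abs_nonneg _) (Finset.mem_univ _)

section Regret

variable (hS : S ≠ 0) (q : Fin S → Fin A → ℝ) (hq : ∀ x a, q x a ∈ Set.Icc (0 : ℝ) 1)

/-- Plays count choices of the policy whether or not `x` is visited; the division by `S` is the
probability of starting in `x`. -/
lemma sum_plays_le_regret (hA : 0 < A) (b : Fin S → Fin A) {K : ℕ}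
    (ω : Fin K → Episode (S + 2) A (n + 1)) :
    ∑ x, ∑ a, (1 + n / 2) * (q x (b x) - q x a) * (plays x a ω / S)
      ≤ Algorithm.regret (gateMDP (n + 1) hS q hq) ω := by
  refine le_trans (le_of_eq ?_) (Finset.sum_le_sum (s := Finset.univ)
    fun k (_ : k ∈ Finset.univ) => gateMDP_le_regret hS q hq hA b (ω k).1)
  have e (k : Fin K) (x : Fin S) : (1 + (n : ℝ) / 2) * (q x (b x) - q x ((ω k).1 0 (Fin.castAdd 2 x)))
      = ∑ a, (1 + n / 2) * (q x (b x) - q x a)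
        * if (ω k).1 0 (Fin.castAdd 2 x) = a then 1 else 0 := by
    simp
  simp only [e, plays, Finset.mul_sum, Finset.sum_div]
  rw [Finset.sum_comm (s := (Finset.univ : Finset (Fin K)))]
  refine Finset.sum_congr rfl fun x _ => ?_
  rw [Finset.sum_comm]
  refine Finset.sum_congr rfl fun k _ => Finset.sum_congr rfl fun a _ => ?_
  ring

lemma sum_integral_plays_le_expectedRegret (hA : 0 < A) (b : Fin S → Fin A)
    (alg : Algorithm (S + 2) A (n + 1)) (K : ℕ) :
    ∑ x, ∑ a, (1 + n / 2) * (q x (b x) - q x a)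
        * ((∫ ω, plays x a ω ∂(Algorithm.historyLaw (gateMDP (n + 1) hS q hq) alg K)) / S)
      ≤ Algorithm.expectedRegret (gateMDP (n + 1) hS q hq) alg K := by
  have hi (x : Fin S) (a : Fin A) : Integrable (fun ω => (1 + n / 2) * (q x (b x) - q x a)
      * (plays x a ω / S)) (Algorithm.historyLaw (gateMDP (n + 1) hS q hq) alg K) :=
    ((integrable_plays x a K _).div_const _).const_mul _
  refine le_trans (le_of_eq ?_) (integral_mono (integrable_finsetSum _ fun x _ =>
    integrable_finsetSum _ fun a _ => hi x a) (integrable_regret _ K _)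
    fun ω => sum_plays_le_regret hS q hq hA b ω)
  rw [integral_finsetSum _ fun x _ => integrable_finsetSum _ fun a _ => hi x a]
  refine Finset.sum_congr rfl fun x _ => ?_
  rw [integral_finsetSum _ fun a _ => hi x a]
  refine Finset.sum_congr rfl fun a _ => ?_
  rw [integral_const_mul, integral_div]

/-- If `a₀` is the best action in `x₀` by a margin `ε`, then not playing it is costly. -/
lemma integral_sub_plays_le_expectedRegret (b : Fin S → Fin A) (hb : ∀ x a, q x a ≤ q x (b x))
    (x₀ : Fin S) {ε : ℝ} (hε : ∀ a, a ≠ b x₀ → q x₀ a + ε ≤ q x₀ (b x₀))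
    (alg : Algorithm (S + 2) A (n + 1)) (K : ℕ) :
    (1 + n / 2) * ε / S
        * ∫ ω, (K - plays x₀ (b x₀) ω) ∂(Algorithm.historyLaw (gateMDP (n + 1) hS q hq) alg K)
      ≤ Algorithm.expectedRegret (gateMDP (n + 1) hS q hq) alg K := by
  rw [← integral_const_mul]
  refine integral_mono (((integrable_const _).sub (integrable_plays _ _ K _)).const_mul _)
    (integrable_regret _ K _) fun ω => ?_
  have e : (K : ℝ) - plays x₀ (b x₀) ω
      = ∑ k, (1 - if (ω k).1 0 (Fin.castAdd 2 x₀) = b x₀ then (1 : ℝ) else 0) := by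
    simp [plays]
  simp only [e, Finset.mul_sum]
  refine Finset.sum_le_sum fun k _ =>
    le_trans ?_ (gateMDP_le_regret hS q hq (b x₀).pos b (ω k).1)
  have h1 := Finset.single_le_sum (f := fun x => (1 + (n : ℝ) / 2)
      * (q x (b x) - q x ((ω k).1 0 (Fin.castAdd 2 x)))) (fun x _ => mul_nonneg (by positivity)
    (sub_nonneg.2 (hb x _))) (Finset.mem_univ x₀)
  refine le_trans ?_ (mul_le_mul_of_nonneg_left h1 (by positivity))
  have h2 : ε * (1 - if (ω k).1 0 (Fin.castAdd 2 x₀) = b x₀ then (1 : ℝ) else 0)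
      ≤ q x₀ (b x₀) - q x₀ ((ω k).1 0 (Fin.castAdd 2 x₀)) := by
    split_ifs with h
    · simp [h]
    · linarith [hε _ h]
  calc _ = (S : ℝ)⁻¹ * ((1 + n / 2) * (ε
        * (1 - if (ω k).1 0 (Fin.castAdd 2 x₀) = b x₀ then (1 : ℝ) else 0))) := by ring
    _ ≤ _ := by gcongr

end Regret

/-! ### The logarithmic lower bound on the number of plays. -/

/-- The cost of a change of the parameter at `(x₀, a₀)` from `r` to `r'` is at most proportional to
the number of plays. -/
lemma integral_sum_cost_le (hS : S ≠ 0) (q : Fin S → Fin A → ℝ)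
    (hq : ∀ x a, q x a ∈ Set.Icc (0 : ℝ) 1) (x₀ : Fin S) (a₀ : Fin A) {r r' : ℝ}
    (hr : r ∈ Set.Ioo (0 : ℝ) 1) (hr' : r' ∈ Set.Ioo (0 : ℝ) 1) (h₀ : q x₀ a₀ = r)
    (alg : Algorithm (S + 2) A (n + 1)) (K : ℕ) :
    ∫ ω, ∑ k, rolloutCost x₀ a₀ r r' (ω k).2
        ∂(Algorithm.historyLaw (gateMDP (n + 1) hS q hq) alg K)
      ≤ 2 * ((r - r') ^ 2 / (r' * (1 - r'))) / S
        * ∫ ω, plays x₀ a₀ ω ∂(Algorithm.historyLaw (gateMDP (n + 1) hS q hq) alg K) := by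
  set κ := 2 * ((r - r') ^ 2 / (r' * (1 - r'))) / S with hκ
  set P := Algorithm.historyLaw (gateMDP (n + 1) hS q hq) alg K
  obtain ⟨C, hC⟩ := exists_abs_rolloutCost_le (n := n) x₀ a₀ r r'
  have hcost := measurable_rolloutCost (n := n) x₀ a₀ r r'
  have hmp : Measurable fun e : Episode (S + 2) A (n + 1) =>
      κ * if e.1 0 (Fin.castAdd 2 x₀) = a₀ then (1 : ℝ) else 0 :=
    (measurable_policy fun π : Policy (S + 2) A (n + 1) =>
      κ * if π 0 (Fin.castAdd 2 x₀) = a₀ then (1 : ℝ) else 0).comp measurable_fst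
  -- Subtracting `κ` per play leaves a variable of nonpositive mean given the policy, which is how a
  -- bound per roll out passes to the adaptive record.
  have h := integral_sum_historyLaw_nonpos (gateMDP (n + 1) hS q hq) alg
    (f := fun e => rolloutCost x₀ a₀ r r' e.2
      - κ * if e.1 0 (Fin.castAdd 2 x₀) = a₀ then (1 : ℝ) else 0)
    ((hcost.comp measurable_snd).sub hmp) (C := C + |κ|) (fun e => ?_) (fun π => ?_) K
  · have hc (k : Fin K) : Integrable (fun ω : Fin K → Episode (S + 2) A (n + 1) =>
        rolloutCost x₀ a₀ r r' (ω k).2) P :=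
      integrable_of_abs_le P (hcost.comp (by fun_prop)) fun ω => hC _
    simp only [Finset.sum_sub_distrib, ← Finset.mul_sum] at h
    change ∫ ω, (∑ k, rolloutCost x₀ a₀ r r' (ω k).2 - κ * plays x₀ a₀ ω) ∂P ≤ 0 at h
    rw [integral_sub (integrable_finsetSum _ fun k _ => hc k)
      ((integrable_plays _ _ _ _).const_mul _), integral_const_mul] at h
    linarith
  · refine (abs_sub _ _).trans (add_le_add (hC _) ?_)
    split_ifs <;> simp
  · have : IsProbabilityMeasure ((gateMDP (n + 1) hS q hq).rolloutLaw π) :=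
      MDP.isProbabilityMeasure_mix _ _ fun _ => inferInstance
    have h := integral_rolloutLaw_cost_le hS q hq x₀ a₀ hr hr' h₀ π
    change ∫ τ, (rolloutCost x₀ a₀ r r' τ
      - κ * if π 0 (Fin.castAdd 2 x₀) = a₀ then (1 : ℝ) else 0) ∂_ ≤ 0
    rw [integral_sub (integrable_rolloutCost _ _ _ _ _) (integrable_const _), integral_const]
    simpa using h

/-- The exponential of minus half the cost, in terms of the plays under the two MDPs. -/
lemma exp_neg_plays_le (hS : S ≠ 0) (q q' : Fin S → Fin A → ℝ)
    (hq : ∀ x a, q x a ∈ Set.Icc (0 : ℝ) 1) (hq' : ∀ x a, q' x a ∈ Set.Icc (0 : ℝ) 1)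
    (x₀ : Fin S) (a₀ : Fin A) (hr : q x₀ a₀ ∈ Set.Ioo (0 : ℝ) 1)
    (hr' : q' x₀ a₀ ∈ Set.Ioo (0 : ℝ) 1) (hne : ∀ x a, ¬(x = x₀ ∧ a = a₀) → q' x a = q x a)
    (alg : Algorithm (S + 2) A (n + 1)) {K : ℕ} (hK : 1 ≤ K) {η : ℝ} (hη : 0 < η) :
    Real.exp (-(2 * ((q x₀ a₀ - q' x₀ a₀) ^ 2 / (q' x₀ a₀ * (1 - q' x₀ a₀))) / S
        * ∫ ω, plays x₀ a₀ ω ∂(Algorithm.historyLaw (gateMDP (n + 1) hS q hq) alg K)) / 2)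
      ≤ (η + (∫ ω, plays x₀ a₀ ω ∂(Algorithm.historyLaw (gateMDP (n + 1) hS q hq) alg K)) / K / η
        + (∫ ω, (K - plays x₀ a₀ ω) ∂(Algorithm.historyLaw (gateMDP (n + 1) hS q' hq') alg K))
          / K / η + η) / 2 := by
  have hK0 : (0 : ℝ) < K := by exact_mod_cast hK
  have hρ := measurable_rolloutRatio (n := n) x₀ a₀ (q x₀ a₀) (q' x₀ a₀)
  have hρ0 := rolloutRatio_pos (n := n) hr hr' x₀ a₀
  have h := exp_neg_half_integral_le (P := Algorithm.historyLaw (gateMDP (n + 1) hS q hq) alg K)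
    (P' := Algorithm.historyLaw (gateMDP (n + 1) hS q' hq') alg K)
    (L := fun ω => ∏ k, rolloutRatio x₀ a₀ (q x₀ a₀) (q' x₀ a₀) (ω k).2)
    (W := fun ω => ∑ k, rolloutCost x₀ a₀ (q x₀ a₀) (q' x₀ a₀) (ω k).2)
    (V := fun ω => plays x₀ a₀ ω / K) (by fun_prop)
    (fun ω => Finset.prod_nonneg fun k _ => (hρ0 _).le)
    (fun f hf => lintegral_historyLaw_change _ _ alg hρ (fun τ => (hρ0 τ).le)
      (fun π f hf => lintegral_rolloutLaw_change hS q q' hq hq' x₀ a₀ hr hr' hne π hf) K hf)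
    (integrable_finsetSum _ fun k _ => ?_) (fun ω => ?_)
    ((measurable_plays x₀ a₀ K).div_const _)
    (fun ω => ⟨div_nonneg (plays_nonneg _ _ _) hK0.le, (div_le_one hK0).2 (plays_le _ _ _)⟩) hη
  · have e (ω : Fin K → Episode (S + 2) A (n + 1)) : 1 - plays x₀ a₀ ω / K
        = (K - plays x₀ a₀ ω) / K := by rw [sub_div, div_self hK0.ne']
    simp only [e, integral_div] at h
    refine le_trans (Real.exp_le_exp.2 ?_) h
    linarith [integral_sum_cost_le hS q hq x₀ a₀ hr hr' rfl alg K]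
  · obtain ⟨C, hC⟩ := exists_abs_rolloutCost_le (n := n) x₀ a₀ (q x₀ a₀) (q' x₀ a₀)
    exact integrable_of_abs_le _ ((measurable_rolloutCost _ _ _ _).comp (by fun_prop))
      fun ω => hC _
  · rw [← Finset.sum_neg_distrib, Real.exp_sum]
    exact Finset.prod_le_prod (fun k _ => (Real.exp_pos _).le)
      fun k _ => exp_neg_rolloutCost_le hr hr' x₀ a₀ _

/-- Too few plays of `a₀` would leave the algorithm unable to notice an MDP in which `a₀` is optimal
at `x₀`. Both regret bounds are used at the same `K`, so the algorithm may depend on `K`. -/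
lemma log_sub_le_plays (hS : S ≠ 0) (q : Fin S → Fin A → ℝ)
    (hq : ∀ x a, q x a ∈ Set.Icc (0 : ℝ) 1) (b : Fin S → Fin A)
    (hqb : ∀ x, q x (b x) = 3 / 4) (hqle : ∀ x a, q x a ≤ 3 / 4) (x₀ : Fin S) (a₀ : Fin A) {δ : ℝ}
    (hδ : 0 < δ) (hδ' : δ < 1 / 4) (h₀ : q x₀ a₀ = 3 / 4 - δ) {α : ℝ}
    (alg : ℕ → Algorithm (S + 2) A (n + 1)) (halg : Algorithm.UniformlyGood alg α) :
    ∃ B : ℝ, ∀ K : ℕ, 1 ≤ K → (1 - α) * Real.log K - B ≤ 42 * δ ^ 2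
      * ((∫ ω, plays x₀ a₀ ω ∂(Algorithm.historyLaw (gateMDP (n + 1) hS q hq) (alg K) K)) / S) := by
  classical
  have hA : 0 < A := a₀.pos
  have hS0 : (0 : ℝ) < S := by exact_mod_cast Nat.pos_of_ne_zero hS
  -- The parameter moves by `3 * δ / 2`: `a₀` becomes the best action in `x₀` by the margin `δ / 2`,
  -- and the new parameter stays below 7/8.
  set q' : Fin S → Fin A → ℝ := fun x a => if x = x₀ ∧ a = a₀ then 3 / 4 + δ / 2 else q x a with hq'
  have hq'm (x) (a) : q' x a ∈ Set.Icc (0 : ℝ) 1 := by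
    simp only [hq']
    split_ifs
    · constructor <;> linarith
    · exact hq x a
  set b' : Fin S → Fin A := Function.update b x₀ a₀ with hb'
  have hq'0 : q' x₀ a₀ = 3 / 4 + δ / 2 := by simp [hq']
  have hb'0 : b' x₀ = a₀ := by simp [hb']
  have hmargin (a : Fin A) (ha : a ≠ b' x₀) : q' x₀ a + δ / 2 ≤ q' x₀ (b' x₀) := by
    rw [hb'0] at ha ⊢
    rw [hq'0]
    simp only [hq', ha, and_false, if_false]
    linarith [hqle x₀ a]
  have hbest (x) (a) : q' x a ≤ q' x (b' x) := by
    by_cases hx : x = x₀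
    · subst hx
      by_cases ha : a = b' x
      · rw [ha]
      · linarith [hmargin a ha]
    · simpa [hq', hb', hx, hqb] using hqle x a
  obtain ⟨C, hC, hreg⟩ := halg (gateMDP (n + 1) hS q hq)
  obtain ⟨C', hC', hreg'⟩ := halg (gateMDP (n + 1) hS q' hq'm)
  set g : ℝ := (1 + n / 2) / S with hg
  have hg0 : 0 < g := by positivity
  set D : ℝ := 1 + (C / (g * δ) + C' / (g * (δ / 2))) / 2 with hD
  have hD0 : 0 < D := by positivity
  refine ⟨2 * Real.log D, fun K hK => ?_⟩
  have hK0 : (0 : ℝ) < K := by exact_mod_cast hK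
  set E := ∫ ω, plays x₀ a₀ ω ∂(Algorithm.historyLaw (gateMDP (n + 1) hS q hq) (alg K) K) with hE
  set E' := ∫ ω, (K - plays x₀ a₀ ω)
    ∂(Algorithm.historyLaw (gateMDP (n + 1) hS q' hq'm) (alg K) K) with hE'
  have hE0 (x : Fin S) (a : Fin A) :
      0 ≤ ∫ ω, plays x a ω ∂(Algorithm.historyLaw (gateMDP (n + 1) hS q hq) (alg K) K) :=
    integral_nonneg fun ω => plays_nonneg x a ω
  -- Every term of the regret decomposition is nonnegative because 3/4 is the maximum, so the term
  -- of `(x₀, a₀)` alone is at most the whole regret.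
  have b1 : E ≤ C / (g * δ) * (K : ℝ) ^ α := by
    have h1 := sum_integral_plays_le_expectedRegret hS q hq hA b (alg K) K
    have hterm (x : Fin S) (a : Fin A) : 0 ≤ (1 + (n : ℝ) / 2) * (q x (b x) - q x a)
        * ((∫ ω, plays x a ω ∂(Algorithm.historyLaw (gateMDP (n + 1) hS q hq) (alg K) K)) / S) :=
      mul_nonneg (mul_nonneg (by positivity) (by rw [hqb]; linarith [hqle x a]))
        (div_nonneg (hE0 x a) hS0.le)
    have h2 := (Finset.single_le_sum (fun a _ => hterm x₀ a) (Finset.mem_univ a₀)).trans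
      (Finset.single_le_sum (f := fun x => ∑ a, (1 + (n : ℝ) / 2) * (q x (b x) - q x a)
        * ((∫ ω, plays x a ω ∂(Algorithm.historyLaw (gateMDP (n + 1) hS q hq) (alg K) K)) / S))
        (fun x _ => Finset.sum_nonneg fun a _ => hterm x a) (Finset.mem_univ x₀))
    have h3 := (h2.trans h1).trans (hreg K hK)
    rw [hqb, h₀, ← hE] at h3
    rw [div_mul_eq_mul_div, le_div_iff₀ (by positivity)]
    refine le_of_eq_of_le ?_ h3
    rw [hg]; ring
  have b2 : E' ≤ C' / (g * (δ / 2)) * (K : ℝ) ^ α := by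
    have h1 := (integral_sub_plays_le_expectedRegret hS q' hq'm b' hbest x₀ hmargin
      (alg K) K).trans (hreg' K hK)
    rw [hb'0, ← hE'] at h1
    rw [div_mul_eq_mul_div, le_div_iff₀ (by positivity)]
    refine le_of_eq_of_le ?_ h1
    rw [hg]; ring
  -- With `η² = K ^ (α - 1)` all four terms of the bound are of order `η`, and its logarithm yields
  -- `(1 - α) / 2 * log K`.
  set η : ℝ := (K : ℝ) ^ ((α - 1) / 2) with hη
  have hη0 : 0 < η := Real.rpow_pos_of_pos hK0 _
  have hηK : (K : ℝ) ^ α = η * η * K := by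
    rw [hη, ← Real.rpow_add hK0, ← Real.rpow_add_one hK0.ne']
    ring_nf
  have hexp := exp_neg_plays_le hS q q' hq hq'm x₀ a₀ (by rw [h₀]; constructor <;> linarith)
    (by rw [hq'0]; constructor <;> linarith) (fun x a h => if_neg h) (alg K) hK hη0
  rw [← hE, ← hE'] at hexp
  have b1' : E / K / η ≤ C / (g * δ) * η := by
    rw [div_div, div_le_iff₀ (by positivity)]
    rw [hηK] at b1
    linarith
  have b2' : E' / K / η ≤ C' / (g * (δ / 2)) * η := by
    rw [div_div, div_le_iff₀ (by positivity)]
    rw [hηK] at b2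
    linarith
  have hfin : (η + E / K / η + E' / K / η + η) / 2 ≤ D * η := by
    rw [hD]
    linarith
  have hlog := Real.log_le_log (Real.exp_pos _) (hexp.trans hfin)
  rw [Real.log_exp, Real.log_mul hD0.ne' hη0.ne', hη, Real.log_rpow hK0] at hlog
  -- The numerator is `2 * (3 * δ / 2) ^ 2 = 9 * δ ^ 2 / 2`; on `[3/4, 7/8]` the variance is at
  -- least 7/64, and `(9 / 2) * (64 / 7) < 42`.
  have hχ : 2 * ((q x₀ a₀ - q' x₀ a₀) ^ 2 / (q' x₀ a₀ * (1 - q' x₀ a₀))) ≤ 42 * δ ^ 2 := by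
    rw [h₀, hq'0, mul_div_assoc', div_le_iff₀ (mul_pos (by linarith) (by linarith))]
    have : (7 : ℝ) / 64 ≤ (3 / 4 + δ / 2) * (1 - (3 / 4 + δ / 2)) := by nlinarith
    nlinarith [mul_le_mul_of_nonneg_left this (sq_nonneg δ)]
  have hχ' := mul_le_mul_of_nonneg_right hχ (div_nonneg (hE0 x₀ a₀) hS0.le)
  rw [← hE] at hχ'
  refine le_trans ?_ hχ'
  rw [← mul_div_assoc, ← div_mul_eq_mul_div]
  linarith

/-! ### Passage to the limit and conclusion. -/

lemma le_liminf_div_log {f : ℕ → ℝ} {c B : ℝ} (H : ℕ) (hH : 1 ≤ H)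
    (hf : ∀ K : ℕ, 1 ≤ K → c * Real.log K - B ≤ f K) :
    ((c : ℝ) : EReal) ≤ liminf (fun K : ℕ => ((f K / Real.log ((K : ℝ) * H) : ℝ) : EReal)) atTop := by
  have hH0 : (0 : ℝ) < H := by exact_mod_cast hH
  have hl : Tendsto (fun K : ℕ => Real.log ((K : ℝ) * H)) atTop atTop :=
    Real.tendsto_log_atTop.comp (tendsto_natCast_atTop_atTop.atTop_mul_const hH0)
  -- Since `log K = log (K * H) - log H`, the horizon adds only a constant, which vanishes after
  -- division.
  have ht : Tendsto (fun K : ℕ => c - (c * Real.log H + B) / Real.log ((K : ℝ) * H)) atTop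
      (nhds c) := by
    simpa using tendsto_const_nhds.sub (hl.const_div_atTop (c * Real.log H + B))
  rw [← ((continuous_coe_real_ereal.tendsto c).comp ht).liminf_eq]
  refine liminf_le_liminf ?_
  filter_upwards [eventually_ge_atTop 1, hl.eventually_gt_atTop 0] with K hK hlK
  have hK0 : (0 : ℝ) < K := by exact_mod_cast hK
  simp only [Function.comp_apply, EReal.coe_le_coe_iff]
  rw [le_div_iff₀ hlK, sub_mul, div_mul_cancel₀ _ hlK.ne', Real.log_mul hK0.ne' hH0.ne']
  linarith [hf K hK]

end EpisodicRL

end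

theorem mainTheorem5 :
    ∃ c : ℝ, 0 < c ∧
      ∀ (S A H : ℕ), 2 ≤ S → 2 ≤ A → 1 ≤ H →
      ∀ Δ : Fin S → Fin A → ℝ,
        (∀ x a, 0 ≤ Δ x a ∧ Δ x a < (H : ℝ) / 8) → (∀ x, ∃ a, Δ x a = 0) →
        ∃ M : EpisodicRL.MDP (S + 2) A H,
          (∀ (x : Fin S) (a : Fin A), M.gap 1 (Fin.castAdd 2 x) a = Δ x a) ∧
          (∀ h : ℕ, 1 ≤ h → h ≤ H → ∀ (j : Fin 2) (a : Fin A), (a : ℕ) ≠ 0 →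
            1 / 2 ≤ M.gap h (Fin.natAdd S j) a) ∧
          ∀ (α : ℝ) (alg : ℕ → EpisodicRL.Algorithm (S + 2) A H),
            EpisodicRL.Algorithm.UniformlyGood alg α →
            ((c * ((1 - α) * ∑ x : Fin S, ∑ a : Fin A,
                if 0 < M.gap 1 (Fin.castAdd 2 x) a
                then (H : ℝ) ^ 2 / M.gap 1 (Fin.castAdd 2 x) a else 0) : ℝ) : EReal)
              ≤ liminf (fun K : ℕ =>
                  ((EpisodicRL.Algorithm.expectedRegret M (alg K) K
                    / Real.log ((K : ℝ) * H) : ℝ) : EReal)) atTop := by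
  open EpisodicRL in
  -- Here `168 = 42 * 4`: 42 from the divergence, 4 from `H ≤ 2 * (1 + n / 2)` squared.
  refine ⟨1 / 168, by norm_num, fun S A H hS hA hH Δ hΔ hΔ0 => ?_⟩
  obtain ⟨n, rfl⟩ : ∃ n, H = n + 1 := ⟨H - 1, by omega⟩
  choose b hb using hΔ0
  have hS' : S ≠ 0 := by omega
  have hA' : 0 < A := by omega
  have hS0 : (0 : ℝ) < S := by exact_mod_cast Nat.pos_of_ne_zero hS'
  have hn : (0 : ℝ) < 1 + n / 2 := by positivity
  set q : Fin S → Fin A → ℝ := fun x a => 3 / 4 - Δ x a / (1 + n / 2) with hq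
  -- The bound `H / 8` on the gaps enters here: with `H ≤ 2 * (1 + n / 2)` it keeps all parameters
  -- above 1/2.
  have hδ (x : Fin S) (a : Fin A) : Δ x a / (1 + (n : ℝ) / 2) < 1 / 4 := by
    rw [div_lt_iff₀ hn]
    have := (hΔ x a).2
    push_cast at this
    linarith [(Nat.cast_nonneg n : (0 : ℝ) ≤ n)]
  have hδ0 (x : Fin S) (a : Fin A) : 0 ≤ Δ x a / (1 + (n : ℝ) / 2) := div_nonneg (hΔ x a).1 hn.le
  have hqm (x : Fin S) (a : Fin A) : q x a ∈ Set.Icc (0 : ℝ) 1 := by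
    constructor <;> simp only [hq] <;> linarith [hδ x a, hδ0 x a]
  have hqb (x : Fin S) : q x (b x) = 3 / 4 := by simp [hq, hb]
  have hqle (x : Fin S) (a : Fin A) : q x a ≤ 3 / 4 := by simp only [hq]; linarith [hδ0 x a]
  have hgap (x : Fin S) (a : Fin A) :
      (gateMDP (n + 1) hS' q hqm).gap 1 (Fin.castAdd 2 x) a = Δ x a := by
    rw [gateMDP_gap_castAdd hS' q hqm hA' x a (b x) fun a => (hqle x a).trans (hqb x).ge, hqb,
      hq, sub_sub_cancel, mul_div_cancel₀ _ hn.ne']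
  refine ⟨gateMDP (n + 1) hS' q hqm, hgap,
    fun h _ hh j a ha => (gateMDP_gap_natAdd hS' q hqm hh j a ha).ge, fun α alg halg => ?_⟩
  simp only [hgap]
  have hB (x : Fin S) (a : Fin A) : ∃ B : ℝ, ∀ K : ℕ, 1 ≤ K →
      1 / 168 * (1 - α) * (if 0 < Δ x a then ((n + 1 : ℕ) : ℝ) ^ 2 / Δ x a else 0) * Real.log K - B
        ≤ (1 + n / 2) * (q x (b x) - q x a) * ((∫ ω, plays x a ω
          ∂(Algorithm.historyLaw (gateMDP (n + 1) hS' q hqm) (alg K) K)) / S) := by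
    split_ifs with hx
    · obtain ⟨B, hB⟩ := log_sub_le_plays hS' q hqm b hqb hqle x a (div_pos hx hn) (hδ x a) rfl
        alg halg
      -- Multiplying the bound on plays by `H² / (168 * Δ)` turns its right side into the regret
      -- contribution `Δ * E`.
      refine ⟨((n + 1 : ℕ) : ℝ) ^ 2 / Δ x a / 168 * B, fun K hK => ?_⟩
      have h := hB K hK
      have hE : 0 ≤ (∫ ω, plays x a ω
          ∂(Algorithm.historyLaw (gateMDP (n + 1) hS' q hqm) (alg K) K)) / S :=
        div_nonneg (integral_nonneg fun ω => plays_nonneg x a ω) hS0.le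
      set E := (∫ ω, plays x a ω
          ∂(Algorithm.historyLaw (gateMDP (n + 1) hS' q hqm) (alg K) K)) / S
      have e : (1 + (n : ℝ) / 2) * (q x (b x) - q x a) = Δ x a := by
        rw [hqb, hq, sub_sub_cancel, mul_div_cancel₀ _ hn.ne']
      rw [e]
      have hH0 : (0 : ℝ) < ((n + 1 : ℕ) : ℝ) ^ 2 := by positivity
      have h1 : 42 * (Δ x a / (1 + (n : ℝ) / 2)) ^ 2 ≤ 168 * Δ x a ^ 2 / ((n + 1 : ℕ) : ℝ) ^ 2 := by
        rw [div_pow, mul_div_assoc', div_le_div_iff₀ (by positivity) hH0]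
        have : ((n + 1 : ℕ) : ℝ) ^ 2 ≤ 4 * (1 + (n : ℝ) / 2) ^ 2 := by
          push_cast
          nlinarith [(Nat.cast_nonneg n : (0 : ℝ) ≤ n)]
        nlinarith [mul_le_mul_of_nonneg_left this (sq_nonneg (Δ x a))]
      have h2 := h.trans (mul_le_mul_of_nonneg_right h1 hE)
      have h3 := mul_le_mul_of_nonneg_left h2
        (by positivity : 0 ≤ ((n + 1 : ℕ) : ℝ) ^ 2 / Δ x a / 168)
      have e2 : ((n + 1 : ℕ) : ℝ) ^ 2 / Δ x a / 168 * (168 * Δ x a ^ 2 / ((n + 1 : ℕ) : ℝ) ^ 2 * E)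
          = Δ x a * E := by
        have := hx.ne'
        have := hH0.ne'
        field_simp
      rw [e2] at h3
      linarith
    · refine ⟨0, fun K hK => ?_⟩
      simp only [mul_zero, zero_mul, sub_zero]
      exact mul_nonneg (mul_nonneg hn.le (by rw [hqb]; linarith [hqle x a]))
        (div_nonneg (integral_nonneg fun ω => plays_nonneg x a ω) hS0.le)
  choose B hB using hB
  refine le_liminf_div_log (B := ∑ x, ∑ a, B x a) (n + 1) hH fun K hK => ?_
  refine le_trans (le_of_eq ?_) ((Finset.sum_le_sum fun x _ => Finset.sum_le_sum fun a _ =>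
    hB x a K hK).trans (sum_integral_plays_le_expectedRegret hS' q hqm hA' b (alg K) K))
  simp only [Finset.sum_sub_distrib, ← Finset.sum_mul, ← Finset.mul_sum, mul_assoc]
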